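/- All graphs are finite and simple. For graphs $H,G$ let $\mathrm{ind}(H,G)$ be the number of sets $S\subseteq V(G)$ such that the induced subgraph $G[S]$ is isomorphic to $H$, and let $\mathcal G_k$ be the set of isomorphism classes of graphs with at most $k$ vertices. A graph polynomial $p$ assigns to each graph $G$ a polynomial $p(G)=\sum_{i\ge 0} e_i(G)z^i\in\mathbb C[z]$ that depends only on the isomorphism class of $G$. It is multiplicative if $p(\emptyset)=1$ and $p(G_1\cup G_2)=p(G_1)p(G_2)$ for disjoint unions. A multiplicative graph polynomial $p$ with $e_0(G)=1$ for all $G$ is a bounded induced graph counting polynomial (BIGCP) if there are constants $\alpha,\beta\in\mathbb N$ and complex numbers $\lambda_{H,i}$ such that (i) $e_i(G)=\sum_{H\in\mathcal G_{\alpha i}}\lambda_{H,i}\,\mathrm{ind}(H,G)$ for all graphs $G$ and all $i$ (where $e_i(G)=0$ for $i>\deg p(G)$), and (ii) there is an algorithm that, given $i$ and a graph $H$ with at most $\alpha i$ vertices, computes $\lambda_{H,i}$ in time $O(\beta^{|V(H)|})$. The $j$-th inverse power sum of a polynomial with non-zero roots $\zeta_1,\dots,\zeta_d$ (with multiplicity)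 is $\zeta_1^{-j}+\dots+\zeta_d^{-j}$. Algorithms are deterministic programs on lists and exact real numbers, with unit cost for list operations and for arithmetic and comparison of reals, and may use real constants; graphs are given by adjacency lists, and complex numbers by their real and imaginary parts. Theorem. Let $C>0$ and $\Delta\in\mathbb N$, and let $p$ be a BIGCP. Then there are a deterministic algorithm and a constant $K$ such that, given any $n\ge 1$, any $n$-vertex graph $G$ of maximum degree at most $\Delta$ and any real $\varepsilon>0$, the algorithm computes the inverse power sums $p_1,\dots,p_m$ of $p(G)$ for $m=\max(0,\lceil C\ln(n/\varepsilon)\rceil)$ in time at most $K\max(n,n/\varepsilon)^K$. In particular, for $\varepsilon\le 1$ the running time is $(n/\varepsilon)^{O(1)}$. -/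

import Mathlib

open Polynomial

noncomputable section

/-! ### Isomorphism classes of finite graphs -/

/-- Two finite graphs with vertex sets `Fin m`, `Fin n` are identified if they are isomorphic. -/
instance graphSetoid : Setoid (Σ n : ℕ, SimpleGraph (Fin n)) where
  r G H := Nonempty (G.2 ≃g H.2)
  iseqv :=
    { refl := fun _ => ⟨SimpleGraph.Iso.refl⟩
      symm := fun ⟨e⟩ => ⟨e.symm⟩
      trans := fun ⟨e⟩ ⟨f⟩ => ⟨e.trans f⟩ }

/-- The collection of all finite simple graphs, up to isomorphism. A graph invariant with values
in `S` is a function `GraphClass → S`. -/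
def GraphClass : Type := Quotient graphSetoid

/-- The isomorphism class of a finite graph. -/
def isoClass {V : Type*} [Finite V] (G : SimpleGraph V) : GraphClass :=
  Quotient.mk graphSetoid ⟨Nat.card V, G.comap (Finite.equivFin V).symm⟩

/-- The number of vertices. -/
def GraphClass.order (H : GraphClass) : ℕ :=
  Quotient.lift (s := graphSetoid) (fun G : Σ n : ℕ, SimpleGraph (Fin n) => G.1)
    (fun _ _ ⟨e⟩ => by simpa using Fintype.card_congr e.toEquiv) H

theorem isoClass_eq_iff {V W : Type*} [Finite V] [Finite W]
    (G : SimpleGraph V) (H : SimpleGraph W) :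
    isoClass G = isoClass H ↔ Nonempty (G ≃g H) := by
  have key : ∀ {U : Type _} [Finite U] (F : SimpleGraph U),
      Nonempty (F.comap (Finite.equivFin U).symm ≃g F) :=
    fun F => ⟨⟨(Finite.equivFin _).symm, Iff.rfl⟩⟩
  have key' : ∀ {U : Type _} [Finite U] (F : SimpleGraph U),
      Nonempty (F.comap (Finite.equivFin U).symm ≃g F) :=
    fun F => ⟨⟨(Finite.equivFin _).symm, Iff.rfl⟩⟩
  obtain ⟨a⟩ := key G
  obtain ⟨b⟩ := key' H
  constructor
  · intro h
    obtain ⟨e⟩ := Quotient.exact (s := graphSetoid) h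
    exact ⟨a.symm.trans (RelIso.trans e b)⟩
  · rintro ⟨e⟩
    exact Quotient.sound (s := graphSetoid) ⟨a.trans (e.trans b.symm)⟩

theorem GraphClass.finite_order_le (k : ℕ) : {H : GraphClass | H.order ≤ k}.Finite := by
  have h : (Set.range fun G : Σ n : Fin (k + 1), SimpleGraph (Fin n) =>
      (Quotient.mk graphSetoid ⟨G.1, G.2⟩ : GraphClass)).Finite := Set.finite_range _
  refine h.subset ?_
  intro H hH
  induction H using Quotient.inductionOn with
  | h G => exact ⟨⟨⟨G.1, Nat.lt_succ_of_le hH⟩, G.2⟩, rfl⟩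

/-- The graphs with at most `k` vertices, up to isomorphism. -/
def GraphClass.orderLE (k : ℕ) : Finset GraphClass := (GraphClass.finite_order_le k).toFinset

/-- `ind H G` is the number of vertex sets `S` such that `G[S]` is isomorphic to `H`. -/
def ind (H : GraphClass) {V : Type*} [Finite V] (G : SimpleGraph V) : ℕ :=
  {S : Set V | isoClass (G.induce S) = H}.ncard

/-! ### The model of computation

Data are S-expressions whose atoms are `nil` and real numbers. Programs are the point-free
programs of pure Lisp over these data. The primitive operations are `cons` / `car` / `cdr`, a type
test, the four arithmetic operations on exact real numbers, real constants and the comparison of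
two reals, all at unit cost, as in the real RAM and in the Blum–Shub–Smale model. As S-expressions
are immutable, handing one on is copying a pointer, so that every unit of cost is a constant number
of operations of a real RAM. -/

/-- S-expressions over the reals. -/
inductive Val : Type
  | nil : Val
  | num (x : ℝ) : Val
  | cons (a b : Val) : Val

/-- Truth values: `nil` is false, everything else is true. -/
def Val.ofProp (q : Prop) [Decidable q] : Val := if q then Val.num 1 else Val.nil

/-- The primitive operations. -/
inductive Op : Type
  | id | nil | const (c : ℝ)
  | car | cdr | consp
  | add | sub | mul | div | le

/-- The (partial) effect of a primitive operation: `none` is a run-time error. -/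
def Op.apply : Op → Val → Option Val
  | .id, v => some v
  | .nil, _ => some .nil
  | .const c, _ => some (.num c)
  | .car, .cons a _ => some a
  | .cdr, .cons _ b => some b
  | .consp, .cons _ _ => some (.num 1)
  | .consp, _ => some .nil
  | .add, .cons (.num x) (.num y) => some (.num (x + y))
  | .sub, .cons (.num x) (.num y) => some (.num (x - y))
  | .mul, .cons (.num x) (.num y) => some (.num (x * y))
  | .div, .cons (.num x) (.num y) => open Classical in if y = 0 then none else some (.num (x / y))
  | .le, .cons (.num x) (.num y) => open Classical in some (Val.ofProp (x ≤ y))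
  | _, _ => none

/-- Programs; each maps an S-expression to an S-expression. -/
inductive Prog : Type
  /-- a primitive operation -/
  | op (o : Op) : Prog
  /-- `P` followed by `Q` -/
  | seq (P Q : Prog) : Prog
  /-- run both `P` and `Q` on the same argument and `cons` the results -/
  | fork (P Q : Prog) : Prog
  /-- if the test `T` is true of the argument, run `P` on it, otherwise `Q` -/
  | ite (T P Q : Prog) : Prog
  /-- as long as the test `T` is true of the current value, replace that value by means of `P` -/
  | loop (T P : Prog) : Prog

/-- `P.Run v w t`: on input `v`, the program `P` halts without error with output `w`
after exactly `t` steps. -/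
inductive Prog.Run : Prog → Val → Val → ℕ → Prop
  | op {o v w} : o.apply v = some w → Run (.op o) v w 1
  | seq {P Q u v w s t} : Run P u v s → Run Q v w t → Run (.seq P Q) u w (s + t + 1)
  | fork {P Q u v w s t} : Run P u v s → Run Q u w t → Run (.fork P Q) u (.cons v w) (s + t + 1)
  | ite_true {T P Q u b w s t} : Run T u b s → b ≠ .nil → Run P u w t →
      Run (.ite T P Q) u w (s + t + 1)
  | ite_false {T P Q u w s t} : Run T u .nil s → Run Q u w t → Run (.ite T P Q) u w (s + t + 1)
  | loop_done {T P u s} : Run T u .nil s → Run (.loop T P) u u (s + 1)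
  | loop_step {T P u b v w s t r} : Run T u b s → b ≠ .nil → Run P u v t →
      Run (.loop T P) v w r → Run (.loop T P) u w (s + t + r + 1)

/-- Programs are deterministic: the input determines the output and the number of steps. -/
theorem Prog.Run.deterministic {P : Prog} {u v w : Val} {s t : ℕ}
    (h₁ : P.Run u v s) (h₂ : P.Run u w t) : v = w ∧ s = t := by
  induction h₁ generalizing w t with
  | op h =>
    cases h₂ with
    | op h' => rw [h] at h'; exact ⟨Option.some.inj h', rfl⟩
  | seq _ _ ih₁ ih₂ =>
    cases h₂ with
    | seq a b =>
      obtain ⟨rfl, rfl⟩ := ih₁ a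
      obtain ⟨rfl, rfl⟩ := ih₂ b
      exact ⟨rfl, rfl⟩
  | fork _ _ ih₁ ih₂ =>
    cases h₂ with
    | fork a b =>
      obtain ⟨rfl, rfl⟩ := ih₁ a
      obtain ⟨rfl, rfl⟩ := ih₂ b
      exact ⟨rfl, rfl⟩
  | ite_true _ hb _ ih₁ ih₂ =>
    cases h₂ with
    | ite_true a _ b =>
      obtain ⟨rfl, rfl⟩ := ih₁ a
      obtain ⟨rfl, rfl⟩ := ih₂ b
      exact ⟨rfl, rfl⟩
    | ite_false a _ => exact absurd (ih₁ a).1 hb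
  | ite_false _ _ ih₁ ih₂ =>
    cases h₂ with
    | ite_true a hb _ => exact absurd (ih₁ a).1.symm hb
    | ite_false a b =>
      obtain ⟨_, rfl⟩ := ih₁ a
      obtain ⟨rfl, rfl⟩ := ih₂ b
      exact ⟨rfl, rfl⟩
  | loop_done _ ih =>
    cases h₂ with
    | loop_done a => obtain ⟨_, rfl⟩ := ih a; exact ⟨rfl, rfl⟩
    | loop_step a hb _ _ => exact absurd (ih a).1.symm hb
  | loop_step _ hb _ _ ih₁ ih₂ ih₃ =>
    cases h₂ with
    | loop_done a => exact absurd (ih₁ a).1 hb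
    | loop_step a _ b c =>
      obtain ⟨_, rfl⟩ := ih₁ a
      obtain ⟨rfl, rfl⟩ := ih₂ b
      obtain ⟨rfl, rfl⟩ := ih₃ c
      exact ⟨rfl, rfl⟩

/-! ### Encodings -/

/-- Lists, in the usual way. -/
def encList (l : List Val) : Val := l.foldr Val.cons Val.nil

/-- A complex number is the pair of its real and imaginary parts. -/
def encComplex (z : ℂ) : Val := Val.cons (Val.num z.re) (Val.num z.im)

/-- A graph on `{0, …, n - 1}` is given in adjacency list form: the list, over the vertices `v` in
increasing order, of the increasing lists of the neighbours of `v`. -/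
def encGraph {n : ℕ} (G : SimpleGraph (Fin n)) [DecidableRel G.Adj] : Val :=
  encList ((List.finRange n).map fun v =>
    encList (((List.finRange n).filter fun w => G.Adj v w).map fun w => Val.num ((w : ℕ) : ℝ)))

/-! ### Graph polynomials -/

/-- A multiplicative graph polynomial: it is `1` on the graph without vertices, and takes disjoint
unions to products. -/
def IsMultiplicative (p : GraphClass → ℂ[X]) : Prop :=
  p (isoClass (⊥ : SimpleGraph (Fin 0))) = 1 ∧
    ∀ (m n : ℕ) (G : SimpleGraph (Fin m)) (H : SimpleGraph (Fin n)),
      p (isoClass (SimpleGraph.sum G H)) = p (isoClass G) * p (isoClass H)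

/-- The program `A` computes `lam H i`, for all `i` and all graphs `H` with at most `α * i`
vertices, in time `O(β ^ |V(H)|)`. -/
def ComputesCoefficients (A : Prog) (lam : GraphClass → ℕ → ℂ) (α β : ℕ) : Prop :=
  ∃ K : ℕ, ∀ (k : ℕ) (H : SimpleGraph (Fin k)) [DecidableRel H.Adj] (i : ℕ), k ≤ α * i →
    ∃ t : ℕ, A.Run (Val.cons (encGraph H) (Val.num (i : ℝ))) (encComplex (lam (isoClass H) i)) t ∧
      t ≤ K * β ^ k

/-- Bounded induced graph counting polynomials. -/
structure IsBIGCP (p : GraphClass → ℂ[X]) : Prop where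
  multiplicative : IsMultiplicative p
  coeff_zero : ∀ H : GraphClass, (p H).coeff 0 = 1
  bounded : ∃ (α β : ℕ) (lam : GraphClass → ℕ → ℂ),
    (∀ (n : ℕ) (G : SimpleGraph (Fin n)) (i : ℕ),
      (p (isoClass G)).coeff i =
        ∑ H ∈ GraphClass.orderLE (α * i), lam H i * (ind H G : ℂ)) ∧
    ∃ A : Prog, ComputesCoefficients A lam α β

/-- The `j`-th inverse power sum `ζ₁⁻ʲ + ⋯ + ζ_d⁻ʲ` of a complex polynomial of degree `d` with
roots `ζ₁, …, ζ_d`, listed with multiplicity. -/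
def invPowerSum (q : ℂ[X]) (j : ℕ) : ℂ := (q.roots.map fun ζ => ζ⁻¹ ^ j).sum

end

/-! Newton's identities express `p_j` of `p(G)` through its first `j` coefficients; hence `p_j`,
as a function of vertex subsets, has degree at most `α j`: its Möbius transform vanishes on sets
of more than `α j` vertices. As `p` is multiplicative, `p_j` is additive over disjoint unions, so
the transform also vanishes on disconnected sets. Therefore `p_j` of `p(G)` is the sum of the
transform over the connected sets of `O(log (n / ε))` vertices. In a graph of bounded degree these
are polynomially many and can be listed by a branching search, and at each of them the transform
is a sum over only polynomially many subsets. -/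

noncomputable section

/-! ### Computation in polynomial time on families of inputs -/

/-- The family `t` is bounded by a polynomial in the size `M`. -/
def PolyBounded {ι : Type} (M t : ι → ℕ) : Prop := ∃ c : ℕ, ∀ i, t i ≤ (M i + 2) ^ c

namespace PolyBounded

variable {ι κ : Type} {M s t : ι → ℕ}

theorem mono (h : PolyBounded M t) (hst : ∀ i, s i ≤ t i) : PolyBounded M s :=
  h.imp fun _ hc i => (hst i).trans (hc i)

theorem comap (h : PolyBounded M t) (g : κ → ι) :
    PolyBounded (fun k => M (g k)) (fun k => t (g k)) :=
  h.imp fun _ hc k => hc (g k)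

theorem size_pow (c : ℕ) : PolyBounded M fun i => (M i + 2) ^ c := ⟨c, fun _ => le_rfl⟩

theorem size : PolyBounded M M := (size_pow 1).mono fun i => by simp

theorem const (c : ℕ) : PolyBounded M fun _ => c :=
  ⟨c, fun i => Nat.lt_two_pow_self.le.trans (Nat.pow_le_pow_left (by omega) c)⟩

theorem add (hs : PolyBounded M s) (ht : PolyBounded M t) :
    PolyBounded M fun i => s i + t i := by
  obtain ⟨a, ha⟩ := hs
  obtain ⟨b, hb⟩ := ht
  refine ⟨max a b + 1, fun i => ?_⟩
  have hpow : ∀ c ≤ max a b, (M i + 2) ^ c ≤ (M i + 2) ^ max a b :=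
    fun c hc => Nat.pow_le_pow_right (by omega) hc
  calc
    s i + t i ≤ (M i + 2) ^ max a b + (M i + 2) ^ max a b :=
      add_le_add ((ha i).trans (hpow a (le_max_left a b)))
        ((hb i).trans (hpow b (le_max_right a b)))
    _ ≤ (M i + 2) ^ (max a b + 1) := by rw [← mul_two, pow_succ]; gcongr; omega

theorem mul (hs : PolyBounded M s) (ht : PolyBounded M t) :
    PolyBounded M fun i => s i * t i := by
  obtain ⟨a, ha⟩ := hs
  obtain ⟨b, hb⟩ := ht
  exact ⟨a + b, fun i => by rw [pow_add]; exact Nat.mul_le_mul (ha i) (hb i)⟩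

theorem pow (ht : PolyBounded M t) (b : ℕ) : PolyBounded M fun i => t i ^ b := by
  obtain ⟨c, hc⟩ := ht
  exact ⟨c * b, fun i => by rw [pow_mul]; exact Nat.pow_le_pow_left (hc i) b⟩

end PolyBounded

/-- Types whose elements are represented by S-expressions. -/
class Enc (X : Type) where
  enc : X → Val

open Enc (enc)

instance : Enc Bool := ⟨fun b => if b then .num 1 else .nil⟩
instance : Enc ℝ := ⟨.num⟩
instance : Enc ℕ := ⟨fun n => .num n⟩
instance : Enc ℂ := ⟨encComplex⟩
instance {X Y : Type} [Enc X] [Enc Y] : Enc (X × Y) := ⟨fun p => .cons (enc p.1) (enc p.2)⟩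
instance {X : Type} [Enc X] : Enc (List X) := ⟨fun l => encList (l.map enc)⟩

/-- Some program computes the family `x` from the family `u` in time polynomial in the size `M`.
As in `Measurable` or `Primrec`, a composite computation is assembled from such statements about its
parts, all of them over the same input `u`; under a binder, `u` is paired with the bound value. -/
def PolyTime {ι Γ X : Type} [Enc Γ] [Enc X] (M : ι → ℕ) (u : ι → Γ) (x : ι → X) : Prop :=
  ∃ (P : Prog) (t : ι → ℕ), PolyBounded M t ∧ ∀ i, P.Run (enc (u i)) (enc (x i)) (t i)

/-- An index of a family together with a value that is possible there; the bodies of loops are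
families with such indices. -/
structure Idx {ι X : Type} (r : ι → X → Prop) : Type where
  i : ι
  x : X
  prop : r i x

theorem Prog.Run.exists_quote (v : Val) : ∃ P t, ∀ w, Prog.Run P w v t := by
  induction v with
  | nil => exact ⟨.op .nil, 1, fun _ => .op rfl⟩
  | num c => exact ⟨.op (.const c), 1, fun _ => .op rfl⟩
  | cons a b iha ihb =>
    obtain ⟨P, s, hP⟩ := iha
    obtain ⟨Q, t, hQ⟩ := ihb
    exact ⟨.fork P Q, s + t + 1, fun w => .fork (hP w) (hQ w)⟩

theorem Prog.Run.iterate {T P : Prog} {a b : ℕ} (N : ℕ) (s : ℕ → Val)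
    (hs : ∀ j < N, (∃ v ≠ .nil, ∃ t ≤ a, T.Run (s j) v t) ∧ ∃ t ≤ b, P.Run (s j) (s (j + 1)) t)
    (hN : ∃ t ≤ a, T.Run (s N) .nil t) :
    ∃ t ≤ (N + 1) * (a + b + 1), (Prog.loop T P).Run (s 0) (s N) t := by
  induction N generalizing s with
  | zero =>
    obtain ⟨t, ht, h⟩ := hN
    exact ⟨t + 1, by omega, .loop_done h⟩
  | succ N ih =>
    obtain ⟨⟨v, hv, t₁, ht₁, h₁⟩, t₂, ht₂, h₂⟩ := hs 0 (by omega)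
    obtain ⟨t₃, ht₃, h₃⟩ := ih (fun j => s (j + 1)) (fun j hj => hs (j + 1) (by omega)) hN
    refine ⟨t₁ + t₂ + t₃ + 1, ?_, .loop_step h₁ hv h₂ h₃⟩
    have : (N + 1 + 1) * (a + b + 1) = (N + 1) * (a + b + 1) + (a + b + 1) := by ring
    omega

namespace PolyTime

variable {ι κ Γ Γ' X Y Z : Type} [Enc Γ] [Enc Γ'] [Enc X] [Enc Y] [Enc Z] {M : ι → ℕ} {u : ι → Γ}

theorem of_le {x : ι → X} {b : ι → ℕ} (P : Prog) (hb : PolyBounded M b)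
    (h : ∀ i, ∃ t ≤ b i, P.Run (enc (u i)) (enc (x i)) t) : PolyTime M u x := by
  choose t ht h using h
  exact ⟨P, t, hb.mono ht, h⟩

theorem congr {x y : ι → X} (h : PolyTime M u x) (hxy : ∀ i, x i = y i) : PolyTime M u y :=
  funext hxy ▸ h

theorem comap {x : ι → X} (h : PolyTime M u x) (g : κ → ι) :
    PolyTime (fun k => M (g k)) (fun k => u (g k)) (fun k => x (g k)) := by
  obtain ⟨P, t, ht, h⟩ := h
  exact ⟨P, _, ht.comap g, fun k => h (g k)⟩

theorem op (o : Op) {x : ι → X} (h : ∀ i, o.apply (enc (u i)) = some (enc (x i))) :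
    PolyTime M u x :=
  ⟨.op o, _, .const 1, fun i => .op (h i)⟩

theorem refl : PolyTime M u u := op .id fun _ => rfl

theorem trans {x : ι → X} {y : ι → Y} (hx : PolyTime M u x) (hy : PolyTime M x y) :
    PolyTime M u y := by
  obtain ⟨P, s, hs, hP⟩ := hx
  obtain ⟨Q, t, ht, hQ⟩ := hy
  exact ⟨.seq P Q, _, (hs.add ht).add (.const 1), fun i => .seq (hP i) (hQ i)⟩

theorem pair {x : ι → X} {y : ι → Y} (hx : PolyTime M u x) (hy : PolyTime M u y) :
    PolyTime M u fun i => (x i, y i) := by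
  obtain ⟨P, s, hs, hP⟩ := hx
  obtain ⟨Q, t, ht, hQ⟩ := hy
  exact ⟨.fork P Q, _, (hs.add ht).add (.const 1), fun i => .fork (hP i) (hQ i)⟩

theorem const (x : X) : PolyTime M u fun _ => x := by
  obtain ⟨P, t, hP⟩ := Prog.Run.exists_quote (enc x)
  exact ⟨P, _, .const t, fun i => hP _⟩

theorem op₂ (o : Op) {x : ι → X} {y : ι → Y} {z : ι → Z} (hx : PolyTime M u x)
    (hy : PolyTime M u y) (h : ∀ i, o.apply (.cons (enc (x i)) (enc (y i))) = some (enc (z i))) :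
    PolyTime M u z :=
  (hx.pair hy).trans (op o h)

theorem fst {z : ι → X × Y} (hz : PolyTime M u z) : PolyTime M u fun i => (z i).1 :=
  hz.trans (op .car fun _ => rfl)

theorem snd {z : ι → X × Y} (hz : PolyTime M u z) : PolyTime M u fun i => (z i).2 :=
  hz.trans (op .cdr fun _ => rfl)

theorem var {x : ι → X} : PolyTime M (fun i => (x i, u i)) x := fst refl

theorem push {x : ι → X} {y : ι → Y} (hy : PolyTime M u y) : PolyTime M (fun i => (x i, u i)) y :=
  (snd refl).trans hy

theorem lift {W : Type} {r : ι → W → Prop} {x : Idx r → X} {y : ι → Y} (hy : PolyTime M u y) :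
    PolyTime (fun j : Idx r => M j.i) (fun j => (x j, u j.i)) fun j => y j.i :=
  (hy.comap Idx.i).push

theorem ite {b : ι → Bool} {x : ι → X} (hb : PolyTime M u b)
    (htrue : PolyTime (fun i : {i // b i = true} => M i) (fun i => u i) fun i => x i)
    (hfalse : PolyTime (fun i : {i // b i = false} => M i) (fun i => u i) fun i => x i) :
    PolyTime M u x := by
  obtain ⟨T, a, ha, hT⟩ := hb
  obtain ⟨P, p, ⟨cp, hp⟩, hP⟩ := htrue
  obtain ⟨Q, q, ⟨cq, hq⟩, hQ⟩ := hfalse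
  refine of_le (.ite T P Q) (((ha.add (.size_pow cp)).add (.size_pow cq)).add (.const 1))
    fun i => ?_
  have hTi := hT i
  cases hbi : b i with
  | true =>
    have := hp ⟨i, hbi⟩
    refine ⟨_, ?_, .ite_true hTi (by simp [hbi, enc]) (hP ⟨i, hbi⟩)⟩
    dsimp only at *
    omega
  | false =>
    have := hq ⟨i, hbi⟩
    refine ⟨_, ?_, .ite_false (by simpa [hbi, enc] using hTi) (hQ ⟨i, hbi⟩)⟩
    dsimp only at *
    omega

theorem cond {b : ι → Bool} {x y : ι → X} (hb : PolyTime M u b) (hx : PolyTime M u x)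
    (hy : PolyTime M u y) : PolyTime M u fun i => if b i then x i else y i :=
  ite hb ((hx.comap Subtype.val).congr fun i => by simp [i.2])
    ((hy.comap Subtype.val).congr fun i => by simp [i.2])

theorem loop {N : ι → ℕ} (hN : PolyBounded M N) (s : ι → ℕ → X)
    (htest : PolyTime (fun j : Idx fun i k => k ≤ N i => M j.i) (fun j => s j.i j.x)
      fun j => decide (j.x < N j.i))
    (hstep : PolyTime (fun j : Idx fun i k => k < N i => M j.i) (fun j => s j.i j.x)
      fun j => s j.i (j.x + 1)) :
    PolyTime M (fun i => s i 0) fun i => s i (N i) := by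
  obtain ⟨T, a, ⟨ca, ha⟩, hT⟩ := htest
  obtain ⟨P, p, ⟨cp, hp⟩, hP⟩ := hstep
  refine of_le (.loop T P)
    ((hN.add (.const 1)).mul (((PolyBounded.size_pow ca).add (.size_pow cp)).add (.const 1)))
    fun i => Prog.Run.iterate (N i) (fun k => enc (s i k)) (fun k hk => ⟨?_, ?_⟩) ?_
  · exact ⟨_, by simp [enc, hk], _, ha _, hT ⟨i, k, hk.le⟩⟩
  · exact ⟨_, hp _, hP ⟨i, k, hk⟩⟩
  · exact ⟨_, ha _, by simpa [enc] using hT ⟨i, N i, le_rfl⟩⟩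

/-! ### Arithmetic -/

theorem not {b : ι → Bool} (hb : PolyTime M u b) : PolyTime M u fun i => !b i :=
  (hb.cond (const false) (const true)).congr fun i => by cases b i <;> rfl

theorem and {b c : ι → Bool} (hb : PolyTime M u b) (hc : PolyTime M u c) :
    PolyTime M u fun i => b i && c i :=
  (hb.cond hc (const false)).congr fun i => by cases b i <;> rfl

theorem or {b c : ι → Bool} (hb : PolyTime M u b) (hc : PolyTime M u c) :
    PolyTime M u fun i => b i || c i :=
  (hb.cond (const true) hc).congr fun i => by cases b i <;> rfl

theorem real_le {x y : ι → ℝ} (hx : PolyTime M u x) (hy : PolyTime M u y) :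
    PolyTime M u fun i => decide (x i ≤ y i) :=
  op₂ .le hx hy fun i => by by_cases h : x i ≤ y i <;> simp [enc, Op.apply, Val.ofProp, h]

theorem real_add {x y : ι → ℝ} (hx : PolyTime M u x) (hy : PolyTime M u y) :
    PolyTime M u fun i => x i + y i := op₂ .add hx hy fun _ => rfl

theorem real_sub {x y : ι → ℝ} (hx : PolyTime M u x) (hy : PolyTime M u y) :
    PolyTime M u fun i => x i - y i := op₂ .sub hx hy fun _ => rfl

theorem real_mul {x y : ι → ℝ} (hx : PolyTime M u x) (hy : PolyTime M u y) :
    PolyTime M u fun i => x i * y i := op₂ .mul hx hy fun _ => rfl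

theorem nat_cast_real {x : ι → ℕ} (hx : PolyTime M u x) : PolyTime M u fun i => (x i : ℝ) :=
  hx.trans (op .id fun _ => rfl)

theorem nat_le {x y : ι → ℕ} (hx : PolyTime M u x) (hy : PolyTime M u y) :
    PolyTime M u fun i => decide (x i ≤ y i) :=
  (hx.nat_cast_real.real_le hy.nat_cast_real).congr fun i => by simp

theorem nat_lt {x y : ι → ℕ} (hx : PolyTime M u x) (hy : PolyTime M u y) :
    PolyTime M u fun i => decide (x i < y i) :=
  (hy.nat_le hx).not.congr fun i => by simp [← decide_not]

theorem nat_eq {x y : ι → ℕ} (hx : PolyTime M u x) (hy : PolyTime M u y) :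
    PolyTime M u fun i => decide (x i = y i) :=
  ((hx.nat_le hy).and (hy.nat_le hx)).congr fun i => by simp [le_antisymm_iff]

theorem nat_add {x y : ι → ℕ} (hx : PolyTime M u x) (hy : PolyTime M u y) :
    PolyTime M u fun i => x i + y i := op₂ .add hx hy fun i => by simp [enc, Op.apply]

theorem nat_mul {x y : ι → ℕ} (hx : PolyTime M u x) (hy : PolyTime M u y) :
    PolyTime M u fun i => x i * y i := op₂ .mul hx hy fun i => by simp [enc, Op.apply]

theorem re {z : ι → ℂ} (hz : PolyTime M u z) : PolyTime M u fun i => (z i).re :=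
  hz.trans (op .car fun _ => rfl)

theorem im {z : ι → ℂ} (hz : PolyTime M u z) : PolyTime M u fun i => (z i).im :=
  hz.trans (op .cdr fun _ => rfl)

theorem of_re_im {z : ι → ℂ} (hre : PolyTime M u fun i => (z i).re)
    (him : PolyTime M u fun i => (z i).im) : PolyTime M u z :=
  (hre.pair him).trans (op .id fun _ => rfl)

theorem complex_add {z w : ι → ℂ} (hz : PolyTime M u z) (hw : PolyTime M u w) :
    PolyTime M u fun i => z i + w i :=
  of_re_im (hz.re.real_add hw.re) (hz.im.real_add hw.im)

theorem complex_mul {z w : ι → ℂ} (hz : PolyTime M u z) (hw : PolyTime M u w) :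
    PolyTime M u fun i => z i * w i :=
  of_re_im ((hz.re.real_mul hw.re).real_sub (hz.im.real_mul hw.im))
    ((hz.re.real_mul hw.im).real_add (hz.im.real_mul hw.re))

theorem complex_neg {z : ι → ℂ} (hz : PolyTime M u z) : PolyTime M u fun i => -z i :=
  ((const (-1)).complex_mul hz).congr fun i => by ring

theorem nat_cast_complex {x : ι → ℕ} (hx : PolyTime M u x) : PolyTime M u fun i => (x i : ℂ) :=
  of_re_im hx.nat_cast_real (const 0)

end PolyTime

namespace PolyTime

variable {ι κ Γ Γ' X Y Z : Type} [Enc Γ] [Enc Γ'] [Enc X] [Enc Y] [Enc Z] {M : ι → ℕ} {u : ι → Γ}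

/-! ### Iteration and lists -/

theorem count {N : ι → ℕ} {s : ι → ℕ → X} (hN : PolyTime M u N) (hbound : PolyBounded M N)
    (hzero : PolyTime M u fun i => s i 0)
    (hsucc : PolyTime (fun j : Idx fun i k => k < N i => M j.i)
      (fun j => (s j.i j.x, j.x, u j.i)) fun j => s j.i (j.x + 1)) :
    PolyTime M u fun i => s i (N i) := by
  have hloop := loop (M := M) hbound (fun i k => (N i, s i k, k, u i)) (fst refl |>.nat_le
    (snd refl).snd.fst |>.not.congr fun j => by simp [← decide_not])
    ((fst refl).pair (((snd refl).trans hsucc).pair (((snd refl).snd.fst.nat_add (const 1)).pair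
      (snd refl).snd.snd)))
  exact ((hN.pair (hzero.pair ((const 0).pair refl))).trans hloop).snd.fst

theorem complex_pow {z : ι → ℂ} {k : ι → ℕ} (hz : PolyTime M u z) (hk : PolyTime M u k)
    (hbound : PolyBounded M k) : PolyTime M u fun i => z i ^ k i :=
  hk.count (s := fun i k => z i ^ k) hbound ((const 1).congr fun _ => (pow_zero _).symm)
    ((var.complex_mul hz.lift.push).congr fun _ => (pow_succ ..).symm)

theorem nil : PolyTime M u fun _ => ([] : List X) := const []

theorem cons {x : ι → X} {l : ι → List X} (hx : PolyTime M u x) (hl : PolyTime M u l) :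
    PolyTime M u fun i => x i :: l i :=
  (hx.pair hl).trans (op .id fun _ => rfl)

theorem head {l t : ι → List X} {x : ι → X} (hl : PolyTime M u l) (h : ∀ i, l i = x i :: t i) :
    PolyTime M u x :=
  hl.trans (op .car fun i => by rw [h i]; rfl)

theorem tail {l t : ι → List X} {x : ι → X} (hl : PolyTime M u l) (h : ∀ i, l i = x i :: t i) :
    PolyTime M u t :=
  hl.trans (op .cdr fun i => by rw [h i]; rfl)

theorem isEmpty {l : ι → List X} (hl : PolyTime M u l) : PolyTime M u fun i => (l i).isEmpty :=
  (hl.trans (op (x := fun i => !(l i).isEmpty) .consp fun i => by cases l i <;> rfl)).not.congr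
    fun _ => Bool.not_not _

theorem list_cases {l : ι → List X} {y : ι → Y} (hl : PolyTime M u l)
    (hnil : PolyTime (fun i : {i // l i = []} => M i) (fun i => u i) fun i => y i)
    (hcons : PolyTime (fun j : Idx fun i (p : X × List X) => l i = p.1 :: p.2 => M j.i)
      (fun j => (j.x.1, j.x.2, u j.i)) fun j => y j.i) :
    PolyTime M u y := by
  refine hl.isEmpty.ite (hnil.comap fun i : {i // (l i).isEmpty = true} =>
    ⟨i.1, List.isEmpty_iff.mp i.2⟩) ?_
  have hne : ∀ i : {i // (l i).isEmpty = false}, l i ≠ [] := fun i =>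
    List.isEmpty_eq_false_iff.mp i.2
  have huncons : ∀ i : {i // (l i).isEmpty = false}, l i = (l i).head (hne i) :: (l i).tail :=
    fun i => (List.cons_head_tail _).symm
  have hl' := hl.comap (Subtype.val : {i // (l i).isEmpty = false} → ι)
  exact ((hl'.head huncons).pair ((hl'.tail huncons).pair refl)).trans <|
    hcons.comap fun i : {i // (l i).isEmpty = false} =>
      ⟨i.1, ((l i).head (hne i), (l i).tail), huncons i⟩

theorem foldl {l : ι → List X} {a : ι → Y} {f : ι → Y → X → Y} (hl : PolyTime M u l)
    (hbound : PolyBounded M fun i => (l i).length) (ha : PolyTime M u a)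
    (hf : PolyTime (fun j : Idx fun i (p : List X × X) => p.1 ++ [p.2] <+: l i => M j.i)
      (fun j => (j.x.2, j.x.1.foldl (f j.i) (a j.i), u j.i))
      fun j => f j.i (j.x.1.foldl (f j.i) (a j.i)) j.x.2) :
    PolyTime M u fun i => (l i).foldl (f i) (a i) := by
  have hdrop : ∀ j : Idx fun i k => k < (l i).length,
      (l j.i).drop j.x = (l j.i)[j.x]'j.prop :: (l j.i).drop (j.x + 1) :=
    fun j => (List.cons_getElem_drop_succ ..).symm
  have hprefix : ∀ j : Idx fun i k => k < (l i).length,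
      (l j.i).take j.x ++ [(l j.i)[j.x]'j.prop] <+: l j.i := fun j => by
    rw [List.take_append_getElem]
    exact List.take_prefix ..
  have hloop := loop (M := M) hbound
    (fun i k => ((l i).drop k, ((l i).take k).foldl (f i) (a i), u i))
    (var.isEmpty.not.congr fun j => by rw [Bool.eq_iff_iff]; simp)
    ((var.tail hdrop).pair ((((var.head hdrop).pair (snd refl)).trans
      (hf.comap fun j => ⟨j.i, (_, _), hprefix j⟩)).congr (fun j => by
        simp only [← List.take_append_getElem j.prop, List.foldl_append, List.foldl_cons,
          List.foldl_nil])
      |>.pair (snd refl).snd))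
  exact ((hl.pair (ha.pair refl)).trans hloop).snd.fst.congr fun i => by rw [List.take_length]

theorem reverse {l : ι → List X} (hl : PolyTime M u l)
    (hbound : PolyBounded M fun i => (l i).length) : PolyTime M u fun i => (l i).reverse :=
  (foldl (f := fun _ m x => x :: m) hl hbound nil (var.cons var.push)).congr fun i => by simp

theorem foldr {l : ι → List X} {a : ι → Y} {f : ι → X → Y → Y} (hl : PolyTime M u l)
    (hbound : PolyBounded M fun i => (l i).length) (ha : PolyTime M u a)
    (hf : PolyTime (fun j : Idx fun i (p : X × List X) => p.1 :: p.2 <:+ l i => M j.i)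
      (fun j => (j.x.1, j.x.2.foldr (f j.i) (a j.i), u j.i))
      fun j => f j.i j.x.1 (j.x.2.foldr (f j.i) (a j.i))) :
    PolyTime M u fun i => (l i).foldr (f i) (a i) := by
  have hidx : ∀ j : Idx fun i (p : List X × X) => p.1 ++ [p.2] <+: (l i).reverse,
      j.x.2 :: j.x.1.reverse <:+ l j.i := fun j => by
    simpa using List.reverse_suffix.mpr j.prop
  refine (foldl (f := fun i y x => f i x y) (hl.reverse hbound) (by simpa using hbound) ha ?_).congr
    fun _ => List.foldl_reverse
  simpa only [List.foldr_reverse] using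
    hf.comap fun j => ⟨j.i, (j.x.2, j.x.1.reverse), hidx j⟩

theorem append {l m : ι → List X} (hl : PolyTime M u l) (hm : PolyTime M u m)
    (hbound : PolyBounded M fun i => (l i).length) : PolyTime M u fun i => l i ++ m i :=
  (foldr (f := fun _ x m => x :: m) hl hbound hm (var.cons var.push)).congr fun _ =>
    List.foldr_cons_eq_append'

theorem flatMap {l : ι → List X} {f : ι → X → List Y} (hl : PolyTime M u l)
    (hbound : PolyBounded M fun i => (l i).length)
    (hf : PolyTime (fun j : Idx fun i x => x ∈ l i => M j.i) (fun j => (j.x, u j.i))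
      fun j => f j.i j.x)
    (hfbound : PolyBounded (fun j : Idx fun i x => x ∈ l i => M j.i) fun j => (f j.i j.x).length) :
    PolyTime M u fun i => (l i).flatMap (f i) := by
  let g (j : Idx fun i (p : X × List X) => p.1 :: p.2 <:+ l i) : Idx fun i x => x ∈ l i :=
    ⟨j.i, j.x.1, j.prop.subset List.mem_cons_self⟩
  exact (hl.foldr (f := fun i x m => f i x ++ m) hbound nil
    (((var.pair (snd refl).snd).trans (hf.comap g)).append var.push (hfbound.comap g))).congr
    fun i => by induction l i <;> simp_all

theorem map {l : ι → List X} {f : ι → X → Y} (hl : PolyTime M u l)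
    (hbound : PolyBounded M fun i => (l i).length)
    (hf : PolyTime (fun j : Idx fun i x => x ∈ l i => M j.i) (fun j => (j.x, u j.i))
      fun j => f j.i j.x) :
    PolyTime M u fun i => (l i).map (f i) :=
  (hl.flatMap hbound (hf.cons nil) (.const 1)).congr fun _ => (List.map_eq_flatMap ..).symm

theorem filter {l : ι → List X} {f : ι → X → Bool} (hl : PolyTime M u l)
    (hbound : PolyBounded M fun i => (l i).length)
    (hf : PolyTime (fun j : Idx fun i x => x ∈ l i => M j.i) (fun j => (j.x, u j.i))
      fun j => f j.i j.x) :
    PolyTime M u fun i => (l i).filter (f i) :=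
  (hl.flatMap (f := fun i x => if f i x then [x] else []) hbound
    (hf.cond (var.cons nil) nil)
    ((PolyBounded.const 1).mono fun j => by split <;> simp)).congr
    fun i => by induction l i <;> grind

theorem complex_sum {l : ι → List ℂ} (hl : PolyTime M u l)
    (hbound : PolyBounded M fun i => (l i).length) : PolyTime M u fun i => (l i).sum :=
  (hl.foldr (f := fun _ z w => z + w) hbound (const 0) (var.complex_add var.push)).congr
    fun _ => (List.sum_eq_foldr ..).symm

theorem length {l : ι → List X} (hl : PolyTime M u l)
    (hbound : PolyBounded M fun i => (l i).length) : PolyTime M u fun i => (l i).length :=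
  (hl.foldr (f := fun _ _ n => n + 1) hbound (const 0) (var.push.nat_add (const 1))).congr
    fun i => by induction l i <;> simp_all

theorem nat_mem {x : ι → ℕ} {l : ι → List ℕ} (hx : PolyTime M u x) (hl : PolyTime M u l)
    (hbound : PolyBounded M fun i => (l i).length) : PolyTime M u fun i => decide (x i ∈ l i) :=
  (hl.foldr (f := fun i y b => decide (x i = y) || b) hbound (const false)
    ((hx.lift.push.nat_eq var).or var.push)).congr fun i => by
    induction l i <;> simp_all

theorem range {n : ι → ℕ} (hn : PolyTime M u n) (hbound : PolyBounded M n) :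
    PolyTime M u fun i => List.range (n i) :=
  hn.count (s := fun _ k => List.range k) hbound nil <|
    (append var (var.push.cons nil) (by
      simpa using (hbound.comap Idx.i).mono fun j : Idx fun i k => k < n i => j.prop.le)).congr
    fun j => List.range_succ.symm

theorem getD {l : ι → List X} {k : ι → ℕ} {d : ι → X} (hl : PolyTime M u l)
    (hbound : PolyBounded M fun i => (l i).length) (hk : PolyTime M u k) (hd : PolyTime M u d) :
    PolyTime M u fun i => (l i).getD (k i) (d i) := by
  have hfold : ∀ i, (l i).foldl (fun (s : ℕ × X) x => (s.1 + 1, if s.1 = k i then x else s.2))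
      (0, d i) = ((l i).length, (l i).getD (k i) (d i)) := fun i => by
    induction l i using List.reverseRecOn with
    | nil => simp
    | append_singleton m x ih =>
      rw [List.foldl_append, ih]
      grind
  refine (foldl (f := fun i (s : ℕ × X) x => (s.1 + 1, if s.1 = k i then x else s.2)) hl hbound
    ((const 0).pair hd) (((snd refl).fst.fst.nat_add (const 1)).pair ?_)).snd.congr
    fun i => by rw [hfold]
  exact (((snd refl).fst.fst.nat_eq hk.lift.push).cond var (snd refl).fst.snd).congr
    fun j => by simp

theorem sublists' {l : ι → List X} (hl : PolyTime M u l)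
    (hbound : PolyBounded M fun i => 2 ^ (l i).length) :
    PolyTime M u fun i => (l i).sublists' := by
  have hfold : ∀ m : List X, m.foldr (fun x r => r ++ r.map (x :: ·)) [[]] = m.sublists' :=
    fun m => by induction m <;> simp_all
  have hstep : PolyBounded (fun j : Idx fun i (p : X × List X) => p.1 :: p.2 <:+ l i => M j.i)
      fun j => j.x.2.sublists'.length := (hbound.comap Idx.i).mono fun j => by
    rw [List.length_sublists']
    have := j.prop.length_le
    exact Nat.pow_le_pow_right two_pos (by grind)
  refine (hl.foldr (f := fun _ x r => r ++ r.map (x :: ·))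
    (hbound.mono fun i => Nat.lt_two_pow_self.le) (const [[]]) ?_).congr fun i => hfold (l i)
  simp only [hfold]
  exact var.push.append (var.push.map hstep (var.push.cons var)) hstep

end PolyTime

/-! ### The algorithm on lists -/

/-- The adjacency lists of the subgraph induced on the list `U` of vertices, relabelled by the
positions in `U`, of the graph with adjacency lists `g`. -/
def inducedAdj (g : List (List ℕ)) (U : List ℕ) : List (List ℕ) :=
  (List.range U.length).map fun a =>
    (List.range U.length).filter fun b => decide (U.getD b 0 ∈ g.getD (U.getD a 0) [])

/-- The coefficient of `z ^ k` for the subgraph induced on `T`, if `μ U k` is the number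
`λ_{H, k}` of the subgraph `H` induced on `U`. -/
def coeffSum (α : ℕ) (μ : List ℕ → ℕ → ℂ) (T : List ℕ) (k : ℕ) : ℂ :=
  (T.sublists'.map fun U => if U.length ≤ α * k then μ U k else 0).sum

/-- The inverse power sums `p_k, …, p_1` of a polynomial with coefficients `e` and constant
coefficient `1`, by Newton's recurrence. -/
def newton (e : ℕ → ℂ) : ℕ → List ℂ
  | 0 => []
  | k + 1 => -(((List.range k).map fun i => e (i + 1) * (newton e k).getD i 0).sum +
      ((k + 1 : ℕ) : ℂ) * e (k + 1)) :: newton e k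

/-- The `j`-th inverse power sum for the subgraph induced on `T`. -/
def localPowerSum (α : ℕ) (μ : List ℕ → ℕ → ℂ) (j : ℕ) (T : List ℕ) : ℂ :=
  (newton (coeffSum α μ T) j).getD 0 0

/-- The Möbius transform of `f` over the subsets of a set that is given as a list. -/
def listMobius (f : List ℕ → ℂ) (A : List ℕ) : ℂ :=
  (A.sublists'.map fun T => (-1) ^ (A.length + T.length) * f T).sum

/-- A state of the search for connected sets: it stands for the connected sets that contain
`chosen`, avoid `excluded` and are not yet decided at the vertices in `pending`, a list that
includes all neighbours of `chosen` outside `chosen` and `excluded`. -/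
structure SearchState where
  chosen : List ℕ
  excluded : List ℕ
  pending : List ℕ

/-- Deciding the first pending vertex in both ways; no set grows beyond `s` vertices. -/
def searchStep (g : List (List ℕ)) (s : ℕ) : SearchState → List SearchState
  | ⟨A, X, []⟩ => [⟨A, X, []⟩]
  | ⟨A, X, w :: F⟩ =>
    if w ∈ A ∨ w ∈ X then [⟨A, X, F⟩]
    else if A.length < s then [⟨w :: A, X, g.getD w [] ++ F⟩, ⟨A, w :: X, F⟩]
    else [⟨A, w :: X, F⟩]

/-- One state for each vertex `v`, standing for the connected sets with greatest element `v`. -/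
def searchInit (g : List (List ℕ)) : List SearchState :=
  (List.range g.length).map fun v =>
    ⟨[v], (List.range g.length).filter fun w => decide (v < w), g.getD v []⟩

/-- The states of the search after the given number of rounds. -/
def search (g : List (List ℕ)) (s : ℕ) : ℕ → List SearchState
  | 0 => searchInit g
  | r + 1 => (search g s r).flatMap (searchStep g s)

theorem length_newton (e : ℕ → ℂ) (k : ℕ) : (newton e k).length = k := by
  induction k with
  | zero => rfl
  | succ k ih => rw [newton, List.length_cons, ih]

theorem length_getD_nil_le {g : List (List ℕ)} {d : ℕ} (hg : ∀ r ∈ g, r.length ≤ d) (a : ℕ) :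
    (g.getD a []).length ≤ d := by
  by_cases ha : a < g.length
  · rw [List.getD_eq_getElem _ _ ha]
    exact hg _ (List.getElem_mem ha)
  · rw [List.getD_eq_default _ _ (not_lt.mp ha)]
    exact Nat.zero_le d

theorem searchStep_of_pending_eq_nil {g : List (List ℕ)} {s : ℕ} {q : SearchState}
    (h : q.pending = []) : searchStep g s q = [q] := by
  obtain ⟨A, X, F⟩ := q
  subst h
  rfl

theorem searchStep_of_pending_eq_cons {g : List (List ℕ)} {s w : ℕ} {q : SearchState} {F : List ℕ}
    (h : q.pending = w :: F) :
    searchStep g s q =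
      if w ∈ q.chosen ∨ w ∈ q.excluded then [⟨q.chosen, q.excluded, F⟩]
      else if q.chosen.length < s then
        [⟨w :: q.chosen, q.excluded, g.getD w [] ++ F⟩, ⟨q.chosen, w :: q.excluded, F⟩]
      else [⟨q.chosen, w :: q.excluded, F⟩] := by
  obtain ⟨A, X, F'⟩ := q
  subst h
  rfl

theorem length_searchStep_le (g : List (List ℕ)) (s : ℕ) (q : SearchState) :
    (searchStep g s q).length ≤ 2 := by
  unfold searchStep
  split
  · simp
  · split_ifs <;> simp

theorem length_search_le (g : List (List ℕ)) (s r : ℕ) :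
    (search g s r).length ≤ 2 ^ r * g.length := by
  induction r with
  | zero => simp [search, searchInit]
  | succ r ih =>
    calc (search g s (r + 1)).length
        = ((search g s r).map fun q => (searchStep g s q).length).sum := by
          rw [search, List.length_flatMap]
      _ ≤ (search g s r).length * 2 := by
          simpa using List.sum_le_card_nsmul ((search g s r).map fun q => (searchStep g s q).length)
            2 (by simpa using fun q _ => length_searchStep_le g s q)
      _ ≤ 2 ^ r * g.length * 2 := Nat.mul_le_mul_right 2 ih
      _ = 2 ^ (r + 1) * g.length := by ring

theorem length_chosen_le_of_mem_searchStep {g : List (List ℕ)} {s : ℕ} {q q' : SearchState}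
    (h : q' ∈ searchStep g s q) (hq : q.chosen.length ≤ s) : q'.chosen.length ≤ s := by
  unfold searchStep at h
  split at h
  · simp_all
  · split_ifs at h <;> grind

theorem length_excluded_le_of_mem_searchStep {g : List (List ℕ)} {s : ℕ} {q q' : SearchState}
    (h : q' ∈ searchStep g s q) : q'.excluded.length ≤ q.excluded.length + 1 := by
  unfold searchStep at h
  split at h
  · simp_all
  · split_ifs at h <;> grind

/-- An upper bound for the number of vertices still to be examined: those pending, and at most `d`
neighbours of each vertex still to be chosen. -/
def SearchState.potential (d s : ℕ) (q : SearchState) : ℕ :=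
  q.pending.length + d * (s - q.chosen.length)

theorem potential_lt_of_mem_searchStep {g : List (List ℕ)} {s d : ℕ}
    (hg : ∀ r ∈ g, r.length ≤ d) {q q' : SearchState} (h : q' ∈ searchStep g s q) :
    q'.pending = [] ∨ q'.potential d s < q.potential d s := by
  unfold searchStep at h
  split at h
  · left; simp_all
  next A X w F =>
    right
    split_ifs at h with hw hlt
    · obtain rfl := List.mem_singleton.mp h
      simp [SearchState.potential]
    · have hsub : s - A.length = s - (A.length + 1) + 1 := by omega
      have hrow := length_getD_nil_le hg w
      rcases List.mem_pair.mp h with rfl | rfl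
      · simp only [SearchState.potential, List.length_append, List.length_cons, hsub, mul_add]
        omega
      · simp [SearchState.potential]
    · obtain rfl := List.mem_singleton.mp h
      simp [SearchState.potential]

theorem length_chosen_le_of_mem_search {g : List (List ℕ)} {s r : ℕ} (hs : 1 ≤ s) :
    ∀ q ∈ search g s r, q.chosen.length ≤ s := by
  induction r with
  | zero => simpa [search, searchInit] using fun _ _ => hs
  | succ r ih =>
    intro q' hq'
    obtain ⟨q, hq, h⟩ := List.mem_flatMap.mp hq'
    exact length_chosen_le_of_mem_searchStep h (ih q hq)

theorem length_excluded_le_of_mem_search {g : List (List ℕ)} {s r : ℕ} :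
    ∀ q ∈ search g s r, q.excluded.length ≤ g.length + r := by
  induction r with
  | zero =>
    simpa [search, searchInit] using fun v _ =>
      (List.length_filter_le (fun w => decide (v < w)) (List.range g.length)).trans_eq
        List.length_range
  | succ r ih =>
    intro q' hq'
    obtain ⟨q, hq, h⟩ := List.mem_flatMap.mp hq'
    have := ih q hq
    have := length_excluded_le_of_mem_searchStep h
    omega

theorem potential_add_le_of_mem_search {g : List (List ℕ)} {s d r : ℕ}
    (hg : ∀ r ∈ g, r.length ≤ d) (hs : 1 ≤ s) :
    ∀ q ∈ search g s r, q.pending = [] ∨ q.potential d s + r ≤ d * s := by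
  induction r with
  | zero =>
    simp only [search, searchInit, List.mem_map, SearchState.potential, forall_exists_index,
      and_imp, forall_apply_eq_imp_iff₂, List.length_singleton]
    intro v _
    right
    calc (g.getD v []).length + d * (s - 1) + 0 ≤ d + d * (s - 1) := by
          simpa using length_getD_nil_le hg v
      _ = d * s := by rw [add_comm, ← Nat.mul_succ, Nat.succ_eq_add_one, Nat.sub_add_cancel hs]
  | succ r ih =>
    intro q' hq'
    obtain ⟨q, hq, h⟩ := List.mem_flatMap.mp hq'
    rcases ih q hq with hnil | hq
    · rw [searchStep_of_pending_eq_nil hnil, List.mem_singleton] at h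
      exact .inl (h ▸ hnil)
    · exact (potential_lt_of_mem_searchStep hg h).imp_right fun h => by omega

theorem pending_eq_nil_of_mem_search {g : List (List ℕ)} {s d r : ℕ}
    (hg : ∀ r ∈ g, r.length ≤ d) (hs : 1 ≤ s) (hr : d * s ≤ r) :
    ∀ q ∈ search g s r, q.pending = [] := fun q hq =>
  (potential_add_le_of_mem_search hg hs q hq).elim id fun h =>
    List.length_eq_zero_iff.mp (by unfold SearchState.potential at h; omega)

/-! ### Running time of the subroutines -/

instance : Enc SearchState := ⟨fun q => enc (q.chosen, q.excluded, q.pending)⟩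

namespace PolyTime

variable {ι Γ : Type} [Enc Γ] {M : ι → ℕ} {u : ι → Γ} {g : ι → List (List ℕ)}

theorem inducedAdj {U : ι → List ℕ} {d : ℕ} (hg : PolyTime M u g) (hU : PolyTime M u U)
    (hglen : PolyBounded M fun i => (g i).length) (hrow : ∀ i, ∀ l ∈ g i, l.length ≤ d)
    (hUlen : PolyBounded M fun i => (U i).length) :
    PolyTime M u fun i => inducedAdj (g i) (U i) := by
  have hrange := (hU.length hUlen).range hUlen
  have hrangelen : PolyBounded M fun i => (List.range (U i).length).length := by simpa using hUlen
  refine hrange.map hrangelen (hrange.lift.filter (hrangelen.comap Idx.i)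
    (nat_mem (hU.lift.lift.getD ?_ var (const 0))
      (hg.lift.lift.getD ?_ (hU.lift.lift.getD ?_ var.push (const 0)) nil)
      ((PolyBounded.const d).mono fun j => length_getD_nil_le (hrow _) _)))
  · exact (hUlen.comap Idx.i).comap Idx.i
  · exact (hglen.comap Idx.i).comap Idx.i
  · exact (hUlen.comap Idx.i).comap Idx.i

theorem coeffSum {α : ℕ} {μ : ι → List ℕ → ℕ → ℂ} {T : ι → List ℕ} {k : ι → ℕ}
    (hT : PolyTime M u T) (hk : PolyTime M u k) (hTlen : PolyBounded M fun i => 2 ^ (T i).length)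
    (hμ : PolyTime (fun j : Idx fun i U => U ∈ (T i).sublists' ∧ U.length ≤ α * k i => M j.i)
      (fun j => (j.x, u j.i)) fun j => μ j.i j.x (k j.i)) :
    PolyTime M u fun i => coeffSum α (μ i) (T i) (k i) := by
  have hlen : PolyBounded M fun i => (T i).sublists'.length := by simpa using hTlen
  have hUlen : PolyBounded (fun j : Idx fun i U => U ∈ (T i).sublists' => M j.i)
      fun j => j.x.length :=
    (hTlen.comap Idx.i).mono fun j =>
      (List.mem_sublists'.mp j.prop).length_le.trans Nat.lt_two_pow_self.le
  refine ((hT.sublists' hTlen).map (f := fun i U => if U.length ≤ α * k i then μ i U (k i) else 0)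
    hlen ?_).complex_sum (by simpa using hTlen)
  refine ((var.length hUlen).nat_le ((const α).nat_mul hk.lift)).ite ?_ ?_
  · exact (hμ.comap fun j : {j : Idx fun i U => U ∈ (T i).sublists' //
      decide (j.x.length ≤ α * k j.i) = true} => ⟨j.1.i, j.1.x, j.1.prop, by simpa using j.2⟩).congr
      fun j => (if_pos (by simpa using j.2)).symm
  · exact (const 0).congr fun j => (if_neg (by simpa using j.2)).symm

theorem newton {e : ι → ℕ → ℂ} {m : ι → ℕ} (hm : PolyTime M u m) (hbound : PolyBounded M m)
    (he : PolyTime (fun j : Idx fun i k => k ≤ m i => M j.i) (fun j => (j.x, u j.i))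
      fun j => e j.i j.x) :
    PolyTime M u fun i => newton (e i) (m i) := by
  refine hm.count (s := fun i k => _root_.newton (e i) k) hbound nil (cons ?_ var)
  have hk : PolyBounded (fun j : Idx fun i k => k < m i => M j.i) fun j => j.x :=
    (hbound.comap Idx.i).mono fun j => j.prop.le
  have hprev : PolyBounded (fun j : Idx fun i k => k < m i => M j.i)
      fun j => (_root_.newton (e j.i) j.x).length := by simpa only [length_newton] using hk
  have hrange : PolyBounded (fun j : Idx fun i k => k < m i => M j.i)
      fun j => (List.range j.x).length := by simpa using hk
  have hcoeff := he.comap fun j : Idx fun i k => k < m i => ⟨j.i, j.x + 1, j.prop⟩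
  have hterm := he.comap
    fun j : Idx fun (j : Idx fun i k => k < m i) i => i ∈ List.range j.x =>
      ⟨j.i.i, j.x + 1, (List.mem_range.mp j.prop).trans j.i.prop⟩
  refine complex_neg (complex_add (complex_sum (map (var.push.range hk) hrange
    (complex_mul (((var.nat_add (const 1)).pair (snd refl).snd.snd).trans hterm)
      (getD var.push (hprev.comap Idx.i) var (const 0)))) (by simpa using hrange)) ?_)
  exact (var.push.nat_add (const 1)).nat_cast_complex.complex_mul
    (((var.push.nat_add (const 1)).pair (snd refl).snd).trans hcoeff)

theorem localPowerSum {α : ℕ} {μ : ι → List ℕ → ℕ → ℂ} {T : ι → List ℕ} {m : ι → ℕ}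
    (hT : PolyTime M u T) (hm : PolyTime M u m) (hTlen : PolyBounded M fun i => 2 ^ (T i).length)
    (hbound : PolyBounded M m)
    (hμ : PolyTime (fun j : Idx fun i (q : List ℕ × ℕ) =>
        q.1 ∈ (T i).sublists' ∧ q.1.length ≤ α * q.2 => M j.i)
      (fun j => (j.x, u j.i)) fun j => μ j.i j.x.1 j.x.2) :
    PolyTime M u fun i => localPowerSum α (μ i) (m i) (T i) := by
  refine getD (newton hm hbound ?_) (by simpa only [length_newton] using hbound) (const 0) (const 0)
  refine hT.lift.coeffSum var (hTlen.comap Idx.i) ?_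
  exact ((var.pair var.push).pair (snd refl).snd).trans <| hμ.comap
    fun j : Idx fun (j : Idx fun i k => k ≤ m i) U =>
      U ∈ (T j.i).sublists' ∧ U.length ≤ α * j.x => ⟨j.i.i, (j.x, j.i.x), j.prop⟩

theorem listMobius {f : ι → List ℕ → ℂ} {A : ι → List ℕ} (hA : PolyTime M u A)
    (hAlen : PolyBounded M fun i => 2 ^ (A i).length)
    (hf : PolyTime (fun j : Idx fun i T => T ∈ (A i).sublists' => M j.i) (fun j => (j.x, u j.i))
      fun j => f j.i j.x) :
    PolyTime M u fun i => listMobius (f i) (A i) := by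
  have hlen : PolyBounded M fun i => (A i).length := hAlen.mono fun i => Nat.lt_two_pow_self.le
  have hTlen : PolyBounded (fun j : Idx fun i T => T ∈ (A i).sublists' => M j.i)
      fun j => j.x.length :=
    (hlen.comap Idx.i).mono fun j => (List.mem_sublists'.mp j.prop).length_le
  refine ((hA.sublists' hAlen).map (by simpa using hAlen) (complex_mul (complex_pow (const (-1))
    ((hA.lift.length (hlen.comap Idx.i)).nat_add (var.length hTlen)) ?_) hf)).complex_sum
    (by simpa using hAlen)
  exact (hlen.comap Idx.i).add hTlen

theorem chosen {q : ι → SearchState} (hq : PolyTime M u q) : PolyTime M u fun i => (q i).chosen :=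
  hq.trans (op .car fun _ => rfl)

theorem excluded {q : ι → SearchState} (hq : PolyTime M u q) :
    PolyTime M u fun i => (q i).excluded :=
  have hcdr : PolyTime M u fun i => ((q i).excluded, (q i).pending) :=
    hq.trans (op .cdr fun _ => rfl)
  hcdr.fst

theorem pending {q : ι → SearchState} (hq : PolyTime M u q) :
    PolyTime M u fun i => (q i).pending :=
  have hcdr : PolyTime M u fun i => ((q i).excluded, (q i).pending) :=
    hq.trans (op .cdr fun _ => rfl)
  hcdr.snd

theorem searchState {A X F : ι → List ℕ} (hA : PolyTime M u A) (hX : PolyTime M u X)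
    (hF : PolyTime M u F) : PolyTime M u fun i => SearchState.mk (A i) (X i) (F i) :=
  (hA.pair (hX.pair hF)).trans (op .id fun _ => rfl)

theorem searchStep {s : ι → ℕ} {d : ℕ} {q : ι → SearchState} (hg : PolyTime M u g)
    (hs : PolyTime M u s) (hq : PolyTime M u q) (hglen : PolyBounded M fun i => (g i).length)
    (hrow : ∀ i, ∀ l ∈ g i, l.length ≤ d) (hA : PolyBounded M fun i => (q i).chosen.length)
    (hX : PolyBounded M fun i => (q i).excluded.length) :
    PolyTime M u fun i => searchStep (g i) (s i) (q i) := by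
  refine hq.pending.list_cases (((hq.comap Subtype.val).cons nil).congr fun i =>
    (searchStep_of_pending_eq_nil i.2).symm) ?_
  let J := Idx fun i (p : ℕ × List ℕ) => (q i).pending = p.1 :: p.2
  have hg' : PolyTime (fun j : J => M j.i) (fun j => (j.x.1, j.x.2, u j.i)) fun j => g j.i :=
    hg.lift.push
  have hq' : PolyTime (fun j : J => M j.i) (fun j => (j.x.1, j.x.2, u j.i)) fun j => q j.i :=
    hq.lift.push
  have hA' := hA.comap (Idx.i : J → ι)
  have hskip := (hq'.chosen.searchState hq'.excluded var.push).cons nil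
  have hexclude := (hq'.chosen.searchState (var.cons hq'.excluded) var.push).cons nil
  have hchoose := (var.cons hq'.chosen).searchState hq'.excluded
    ((hg'.getD (hglen.comap Idx.i) var nil).append var.push
      ((PolyBounded.const d).mono fun j => length_getD_nil_le (hrow j.i) j.x.1))
  refine (((var.nat_mem hq'.chosen hA').or (var.nat_mem hq'.excluded (hX.comap Idx.i))).cond
    hskip (((hq'.chosen.length hA').nat_lt hs.lift.push).cond (hchoose.cons hexclude)
      hexclude)).congr fun j => ?_
  rw [searchStep_of_pending_eq_cons j.prop]
  simp only [Bool.or_eq_true, decide_eq_true_eq]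

theorem searchInit (hg : PolyTime M u g) (hglen : PolyBounded M fun i => (g i).length) :
    PolyTime M u fun i => searchInit (g i) := by
  have hrange := (hg.length hglen).range hglen
  have hrangelen : PolyBounded M fun i => (List.range (g i).length).length := by simpa using hglen
  exact hrange.map hrangelen ((var.cons nil).searchState
    (hrange.lift.filter (hrangelen.comap Idx.i) (var.push.nat_lt var))
    (hg.lift.getD (hglen.comap Idx.i) var nil))

theorem search {s r : ι → ℕ} {d : ℕ} (hg : PolyTime M u g) (hs : PolyTime M u s)
    (hr : PolyTime M u r) (hglen : PolyBounded M fun i => (g i).length)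
    (hrow : ∀ i, ∀ l ∈ g i, l.length ≤ d) (hs_pos : ∀ i, 1 ≤ s i) (hsbound : PolyBounded M s)
    (hrbound : PolyBounded M fun i => 2 ^ r i) :
    PolyTime M u fun i => search (g i) (s i) (r i) := by
  have hr_le : PolyBounded M r := hrbound.mono fun i => Nat.lt_two_pow_self.le
  let J := Idx fun i k => k < r i
  have hlen : PolyBounded (fun j : J => M j.i)
      fun j => (_root_.search (g j.i) (s j.i) j.x).length :=
    ((hrbound.mul hglen).comap Idx.i).mono fun j => (length_search_le _ _ _).trans
      (Nat.mul_le_mul_right _ (Nat.pow_le_pow_right two_pos j.prop.le))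
  have hg' : PolyTime (fun j : J => M j.i)
      (fun j => (_root_.search (g j.i) (s j.i) j.x, j.x, u j.i)) fun j => g j.i := hg.lift.push
  have hs' : PolyTime (fun j : J => M j.i)
      (fun j => (_root_.search (g j.i) (s j.i) j.x, j.x, u j.i)) fun j => s j.i := hs.lift.push
  refine hr.count (s := fun i k => _root_.search (g i) (s i) k) hr_le (hg.searchInit hglen)
    (flatMap var hlen (searchStep (d := d) hg'.lift hs'.lift var
      ((hglen.comap Idx.i).comap Idx.i) (fun j => hrow _) ?_ ?_)
      ((PolyBounded.const 2).mono fun j => length_searchStep_le _ _ _))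
  · exact ((hsbound.comap Idx.i).comap Idx.i).mono fun j =>
      length_chosen_le_of_mem_search (hs_pos j.i.i) _ j.prop
  · exact (((hglen.add hr_le).comap Idx.i).comap Idx.i).mono fun j =>
      (length_excluded_le_of_mem_search _ j.prop).trans
        (Nat.add_le_add_left j.i.prop.le _)

end PolyTime

/-! ### Inverse power sums -/

theorem derivative_multiset_prod_one_sub {R : Type*} [CommRing R] (s : Multiset R) :
    PowerSeries.derivative R (s.map fun r => 1 - PowerSeries.C r * PowerSeries.X).prod =
      -((s.map fun r => 1 - PowerSeries.C r * PowerSeries.X).prod *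
        PowerSeries.mk fun j => (s.map fun r => r ^ (j + 1)).sum) := by
  induction s using Multiset.induction_on with
  | empty =>
    have hzero : (PowerSeries.mk fun _ : ℕ => (0 : R)) = 0 := by ext; simp
    simp [hzero]
  | cons r s ih =>
    have hmk : (PowerSeries.mk fun j => ((r ::ₘ s).map fun r => r ^ (j + 1)).sum) =
        (PowerSeries.mk fun j => r ^ (j + 1)) +
          PowerSeries.mk fun j => (s.map fun r => r ^ (j + 1)).sum := by
      ext; simp
    have hgeom : (1 - PowerSeries.C r * PowerSeries.X) *
        (PowerSeries.mk fun j => r ^ (j + 1)) = PowerSeries.C r := by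
      ext k
      rw [sub_mul, one_mul, mul_assoc, map_sub, PowerSeries.coeff_C_mul, PowerSeries.coeff_C]
      cases k with
      | zero => simp
      | succ k => simp [PowerSeries.coeff_succ_X_mul, pow_succ']
    have hfactor : PowerSeries.derivative R (1 - PowerSeries.C r * PowerSeries.X) =
        -PowerSeries.C r := by
      simp [Derivation.leibniz]
    rw [hmk, Multiset.map_cons, Multiset.prod_cons, Derivation.leibniz, ih, hfactor]
    simp only [smul_eq_mul]
    linear_combination (s.map fun r => 1 - PowerSeries.C r * PowerSeries.X).prod * hgeom

theorem eq_prod_one_sub_inv_roots {k : Type*} [Field k] {q : k[X]} (hsplits : q.Splits)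
    (hq : q.coeff 0 = 1) : q = (q.roots.map fun ζ => 1 - C ζ⁻¹ * X).prod := by
  have hq0 : q ≠ 0 := by rintro rfl; simp at hq
  have hroot : ∀ ζ ∈ q.roots, ζ ≠ 0 := by
    rintro ζ hζ rfl
    have := (mem_roots hq0).1 hζ
    rw [IsRoot.def, ← coeff_zero_eq_eval_zero, hq] at this
    exact one_ne_zero this
  have hfactor : (q.roots.map fun ζ => X - C ζ).prod =
      C (q.roots.map fun ζ => -ζ).prod * (q.roots.map fun ζ => 1 - C ζ⁻¹ * X).prod := by
    rw [map_multiset_prod, Multiset.map_map, ← Multiset.prod_map_mul]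
    refine congrArg _ (Multiset.map_congr rfl fun ζ hζ => ?_)
    have hinv : C ζ * C ζ⁻¹ = (1 : k[X]) := by
      rw [← C_mul, mul_inv_cancel₀ (hroot ζ hζ), C_1]
    simp only [Function.comp, C_neg]
    linear_combination (-X) * hinv
  have hconst : ((q.roots.map fun ζ => 1 - C ζ⁻¹ * X).prod).coeff 0 = 1 := by
    rw [coeff_zero_multiset_prod, Multiset.map_map]
    simp
  have hprod := hsplits.eq_prod_roots
  rw [hfactor, ← mul_assoc, ← C_mul] at hprod
  have hlead : q.leadingCoeff * (q.roots.map fun ζ => -ζ).prod = 1 := by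
    simpa only [hq, coeff_C_mul, hconst, mul_one] using (congrArg (coeff · 0) hprod).symm
  rwa [hlead, C_1, one_mul] at hprod

theorem derivative_eq_neg_mul_invPowerSum {q : ℂ[X]} (hq : q.coeff 0 = 1) :
    PowerSeries.derivative ℂ (q : PowerSeries ℂ) =
      -((q : PowerSeries ℂ) * PowerSeries.mk fun j => invPowerSum q (j + 1)) := by
  have hcoe : ((q.roots.map fun ζ => ζ⁻¹).map fun r =>
      (1 : PowerSeries ℂ) - PowerSeries.C r * PowerSeries.X).prod = (q : PowerSeries ℂ) := by
    conv_rhs => rw [eq_prod_one_sub_inv_roots (IsAlgClosed.splits q) hq]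
    rw [← Polynomial.coeToPowerSeries.ringHom_apply, map_multiset_prod, Multiset.map_map,
      Multiset.map_map]
    refine congrArg _ (Multiset.map_congr rfl fun ζ _ => ?_)
    simp
  have h := derivative_multiset_prod_one_sub (q.roots.map fun ζ => ζ⁻¹)
  simpa only [hcoe, invPowerSum, Multiset.map_map (fun r => r ^ _), Function.comp_def] using h

theorem invPowerSum_succ {q : ℂ[X]} (hq : q.coeff 0 = 1) (k : ℕ) :
    invPowerSum q (k + 1) = -(∑ i ∈ Finset.range k, q.coeff (i + 1) * invPowerSum q (k - i) +
      ((k + 1 : ℕ) : ℂ) * q.coeff (k + 1)) := by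
  have h := congrArg (PowerSeries.coeff k) (derivative_eq_neg_mul_invPowerSum hq)
  rw [PowerSeries.coeff_derivative, map_neg, PowerSeries.coeff_mul,
    Finset.Nat.sum_antidiagonal_eq_sum_range_succ_mk, Finset.sum_range_succ'] at h
  simp only [Polynomial.coeff_coe, PowerSeries.coeff_mk, hq, one_mul, Nat.sub_zero] at h
  have hshift : ∀ i ∈ Finset.range k, q.coeff (i + 1) * invPowerSum q (k - (i + 1) + 1) =
      q.coeff (i + 1) * invPowerSum q (k - i) := by
    intro i hi
    rw [Finset.mem_range] at hi
    rw [show k - (i + 1) + 1 = k - i by omega]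
  rw [Finset.sum_congr rfl hshift] at h
  push_cast
  linear_combination h

theorem invPowerSum_one (j : ℕ) : invPowerSum 1 j = 0 := by simp [invPowerSum]

theorem invPowerSum_mul {q r : ℂ[X]} (h : q * r ≠ 0) (j : ℕ) :
    invPowerSum (q * r) j = invPowerSum q j + invPowerSum r j := by
  simp [invPowerSum, roots_mul h]

theorem newton_coeff {q : ℂ[X]} (hq : q.coeff 0 = 1) (k : ℕ) :
    newton q.coeff k = (List.range k).map fun i => invPowerSum q (k - i) := by
  induction k with
  | zero => rfl
  | succ k ih =>
    have hterm : ∀ i ∈ List.range k, q.coeff (i + 1) * (newton q.coeff k).getD i 0 =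
        q.coeff (i + 1) * invPowerSum q (k - i) := by
      intro i hi
      rw [ih, List.getD_eq_getElem _ _ (by simpa using hi), List.getElem_map, List.getElem_range]
    rw [newton, List.map_congr_left hterm, ← List.sum_toFinset _ List.nodup_range,
      List.toFinset_range, ← invPowerSum_succ hq, ih, List.range_succ_eq_map]
    simp

/-! ### Set functions -/

section SetFunctions

variable {V R : Type*}

/-- The Möbius transform of a set function. -/
def mobius [Ring R] (f : Finset V → R) (S : Finset V) : R :=
  ∑ T ∈ S.powerset, (-1) ^ (S.card + T.card) * f T

theorem mobius_insert [DecidableEq V] [Ring R] (f : Finset V → R) {a : V} {S : Finset V}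
    (ha : a ∉ S) : mobius f (insert a S) = mobius (fun T => f (insert a T)) S - mobius f S := by
  have hcard : ∀ T ∈ S.powerset, (insert a T).card = T.card + 1 := fun T hT =>
    Finset.card_insert_of_notMem fun h => ha (Finset.mem_powerset.mp hT h)
  have hsecond : ∀ T ∈ S.powerset,
      (-1 : R) ^ (S.card + 1 + (insert a T).card) * f (insert a T) =
        (-1) ^ (S.card + T.card) * f (insert a T) := fun T hT => by
    rw [hcard T hT, show S.card + 1 + (T.card + 1) = S.card + T.card + 2 by ring, pow_add]
    simp
  have hfirst : ∀ T ∈ S.powerset, (-1 : R) ^ (S.card + 1 + T.card) * f T =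
      -((-1) ^ (S.card + T.card) * f T) := fun T _ => by
    rw [add_right_comm, pow_succ]
    simp
  rw [mobius, Finset.sum_powerset_insert ha, Finset.card_insert_of_notMem ha,
    Finset.sum_congr rfl hfirst, Finset.sum_congr rfl hsecond, Finset.sum_neg_distrib, mobius,
    mobius, neg_add_eq_sub]

theorem sum_powerset_mobius [Ring R] (f : Finset V → R) (S : Finset V) :
    ∑ T ∈ S.powerset, mobius f T = f S := by
  classical
  induction S using Finset.induction_on generalizing f with
  | empty => simp [mobius]
  | insert a S ha ih =>
    have hinsert : ∀ T ∈ S.powerset,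
        mobius f (insert a T) = mobius (fun T => f (insert a T)) T - mobius f T := fun T hT =>
      mobius_insert f fun h => ha (Finset.mem_powerset.mp hT h)
    rw [Finset.sum_powerset_insert ha, Finset.sum_congr rfl hinsert, Finset.sum_sub_distrib, ih,
      ih, add_sub_cancel]

theorem eq_of_sum_powerset_eq [AddCommGroup R] {c c' : Finset V → R} {U : Finset V}
    (h : ∀ S ⊆ U, ∑ T ∈ S.powerset, c T = ∑ T ∈ S.powerset, c' T) : c U = c' U := by
  classical
  induction U using Finset.strongInduction with
  | H U ih =>
    have hproper : ∑ T ∈ U.powerset.erase U, c T = ∑ T ∈ U.powerset.erase U, c' T := by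
      refine Finset.sum_congr rfl fun T hT => ?_
      obtain ⟨hne, hsub⟩ := Finset.mem_erase.mp hT
      rw [Finset.mem_powerset] at hsub
      exact ih T (hsub.ssubset_of_ne hne) fun S hS => h S (hS.trans hsub)
    have hU := h U subset_rfl
    rwa [← Finset.add_sum_erase _ c (Finset.mem_powerset_self U),
      ← Finset.add_sum_erase _ c' (Finset.mem_powerset_self U), hproper,
      add_left_inj] at hU

theorem mobius_eq [Ring R] {f c : Finset V → R} {U : Finset V}
    (h : ∀ S ⊆ U, f S = ∑ T ∈ S.powerset, c T) : mobius f U = c U :=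
  eq_of_sum_powerset_eq fun S hS => (sum_powerset_mobius f S).trans (h S hS)

theorem mobius_union_eq_zero [DecidableEq V] [Ring R] {f : Finset V → R} {A B : Finset V}
    (hA : ¬A ⊆ B) (hB : ¬B ⊆ A) (hadd : ∀ S ⊆ A ∪ B, f S = f (S ∩ A) + f (S ∩ B)) :
    mobius f (A ∪ B) = 0 := by
  have hrestrict : ∀ S D : Finset V,
      ∑ T ∈ S.powerset, (if T ⊆ D then mobius f T else 0) = f (S ∩ D) := by
    intro S D
    rw [← Finset.sum_filter, ← sum_powerset_mobius f (S ∩ D)]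
    refine Finset.sum_congr ?_ fun _ _ => rfl
    ext T
    simp only [Finset.mem_filter, Finset.mem_powerset, Finset.subset_inter_iff]
  have hsplit : mobius f (A ∪ B) =
      (if A ∪ B ⊆ A then mobius f (A ∪ B) else 0) +
        if A ∪ B ⊆ B then mobius f (A ∪ B) else 0 :=
    mobius_eq (c := fun T => (if T ⊆ A then mobius f T else 0) + if T ⊆ B then mobius f T else 0)
      fun S hS => by rw [Finset.sum_add_distrib, hrestrict, hrestrict, hadd S hS]
  simpa [Finset.union_subset_iff, hA, hB] using hsplit

theorem sum_map_sublists' [DecidableEq V] [AddCommMonoid R] {f : List V → R} {F : Finset V → R}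
    {l : List V} (hl : l.Nodup) (h : ∀ T ∈ l.sublists', f T = F T.toFinset) :
    (l.sublists'.map f).sum = ∑ S ∈ l.toFinset.powerset, F S := by
  rw [List.map_congr_left h]
  clear h
  induction l generalizing F with
  | nil => simp
  | cons a l ih =>
    rw [List.nodup_cons] at hl
    rw [List.sublists'_cons, List.map_append, List.sum_append, ih hl.2, List.map_map,
      List.toFinset_cons, Finset.sum_powerset_insert (by simpa using hl.1)]
    rw [← ih (F := fun S => F (insert a S)) hl.2]
    simp only [Function.comp_def, List.toFinset_cons]

theorem nodup_of_mem_sublists' {l T : List V} (hl : l.Nodup) (hT : T ∈ l.sublists') : T.Nodup :=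
  hl.sublist (List.mem_sublists'.mp hT)

theorem listMobius_eq {f : List ℕ → ℂ} {F : Finset ℕ → ℂ} {A : List ℕ} (hA : A.Nodup)
    (h : ∀ T ∈ A.sublists', f T = F T.toFinset) : listMobius f A = mobius F A.toFinset :=
  sum_map_sublists' hA fun T hT => by
    rw [h T hT, List.toFinset_card_of_nodup hA,
      List.toFinset_card_of_nodup (nodup_of_mem_sublists' hA hT)]

/-- Set functions of degree at most `d`, that is, combinations of the indicator functions of
`T ⊆ S` with `T.card ≤ d`. -/
def HasDegreeLE [AddCommMonoid R] (d : ℕ) (f : Finset V → R) : Prop :=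
  ∃ c : Finset V → R, (∀ T, d < T.card → c T = 0) ∧ ∀ S, f S = ∑ T ∈ S.powerset, c T

namespace HasDegreeLE

theorem mobius_eq_zero [Ring R] {d : ℕ} {f : Finset V → R} (hf : HasDegreeLE d f)
    {S : Finset V} (hS : d < S.card) : mobius f S = 0 := by
  obtain ⟨c, hc, hf⟩ := hf
  rw [mobius_eq fun T _ => hf T, hc S hS]

variable [CommSemiring R] {d e : ℕ} {f g : Finset V → R}

theorem mono (hf : HasDegreeLE d f) (h : d ≤ e) : HasDegreeLE e f :=
  hf.imp fun _ hc => ⟨fun T hT => hc.1 T (by omega), hc.2⟩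

theorem add (hf : HasDegreeLE d f) (hg : HasDegreeLE d g) :
    HasDegreeLE d fun S => f S + g S := by
  obtain ⟨a, ha, hf⟩ := hf
  obtain ⟨b, hb, hg⟩ := hg
  exact ⟨fun T => a T + b T, fun T hT => by simp [ha T hT, hb T hT],
    fun S => by simp only [hf, hg, Finset.sum_add_distrib]⟩

theorem const_mul (z : R) (hf : HasDegreeLE d f) : HasDegreeLE d fun S => z * f S := by
  obtain ⟨a, ha, hf⟩ := hf
  exact ⟨fun T => z * a T, fun T hT => by simp [ha T hT],
    fun S => by simp only [hf, Finset.mul_sum]⟩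

theorem sum {ι : Type*} {s : Finset ι} {F : ι → Finset V → R}
    (hF : ∀ i ∈ s, HasDegreeLE d (F i)) : HasDegreeLE d fun S => ∑ i ∈ s, F i S := by
  choose! c hc hF using hF
  refine ⟨fun T => ∑ i ∈ s, c i T, fun T hT => Finset.sum_eq_zero fun i hi => hc i hi T hT,
    fun S => ?_⟩
  rw [Finset.sum_comm]
  exact Finset.sum_congr rfl fun i hi => hF i hi S

theorem mul (hf : HasDegreeLE d f) (hg : HasDegreeLE e g) :
    HasDegreeLE (d + e) fun S => f S * g S := by
  classical
  obtain ⟨a, ha, hf⟩ := hf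
  obtain ⟨b, hb, hg⟩ := hg
  refine ⟨fun W => ∑ q ∈ W.powerset ×ˢ W.powerset with q.1 ∪ q.2 = W, a q.1 * b q.2,
    fun W hW => Finset.sum_eq_zero fun q hq => ?_, fun S => ?_⟩
  · have hcard := Finset.card_union_le q.1 q.2
    rw [(Finset.mem_filter.mp hq).2] at hcard
    by_cases hd : d < q.1.card
    · rw [ha _ hd, zero_mul]
    · rw [hb q.2 (by omega), mul_zero]
  · have hunion : ∀ q ∈ S.powerset ×ˢ S.powerset, q.1 ∪ q.2 ∈ S.powerset := fun q hq => by
      simp only [Finset.mem_product, Finset.mem_powerset] at hq ⊢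
      exact Finset.union_subset hq.1 hq.2
    simp only [hf, hg]
    rw [Finset.sum_mul_sum, ← Finset.sum_product',
      ← Finset.sum_fiberwise_of_maps_to hunion]
    refine Finset.sum_congr rfl fun W hW => Finset.sum_congr ?_ fun _ _ => rfl
    rw [Finset.mem_powerset] at hW
    ext q
    simp only [Finset.mem_filter, Finset.mem_product, Finset.mem_powerset]
    constructor
    · rintro ⟨-, rfl⟩
      exact ⟨⟨Finset.subset_union_left, Finset.subset_union_right⟩, rfl⟩
    · rintro ⟨⟨h₁, h₂⟩, h⟩
      exact ⟨⟨h₁.trans hW, h₂.trans hW⟩, h⟩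

theorem invPowerSum {α : ℕ} {q : Finset V → ℂ[X]} (hzero : ∀ S, (q S).coeff 0 = 1)
    (hq : ∀ i, HasDegreeLE (α * i) fun S => (q S).coeff i) (k : ℕ) :
    HasDegreeLE (α * (k + 1)) fun S => invPowerSum (q S) (k + 1) := by
  induction k using Nat.strong_induction_on with
  | _ k ih =>
    have hterm : ∀ i ∈ Finset.range k, HasDegreeLE (α * (k + 1))
        fun S => (q S).coeff (i + 1) * _root_.invPowerSum (q S) (k - i) := by
      intro i hi
      rw [Finset.mem_range] at hi
      obtain ⟨j, rfl⟩ := Nat.exists_eq_add_of_lt hi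
      have hj := ih j (by omega)
      rw [show i + j + 1 - i = j + 1 by omega]
      exact ((hq (i + 1)).mul hj).mono 
        (by rw [← mul_add]; exact Nat.mul_le_mul_left α (by omega))
    have hneg := ((sum hterm).add ((hq (k + 1)).const_mul ((k + 1 : ℕ) : ℂ))).const_mul (-1)
    simpa only [invPowerSum_succ (hzero _), neg_one_mul] using hneg

end HasDegreeLE

end SetFunctions

/-! ### Induced subgraphs -/

section InducedSubgraphs

variable {V W : Type*} (G : SimpleGraph V)

/-- The isomorphism class of the subgraph induced on a finite set of vertices. -/
def subClass (S : Finset V) : GraphClass := isoClass (G.induce (S : Set V))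

theorem order_subClass (S : Finset V) : (subClass G S).order = S.card :=
  (Nat.card_coe_set_eq _).trans (Set.ncard_coe_finset S)

theorem isoClass_comap [Fintype W] (φ : W ↪ V) :
    isoClass (G.comap φ) = subClass G (Finset.univ.map φ) :=
  (isoClass_eq_iff _ _).2 ⟨⟨(Equiv.ofInjective φ φ.injective).trans
    (Equiv.setCongr (by simp)), Iff.rfl⟩⟩

theorem subClass_comap (φ : W ↪ V) (A : Finset W) :
    subClass (G.comap φ) A = subClass G (A.map φ) :=
  (isoClass_eq_iff _ _).2 ⟨⟨(Equiv.Set.image φ A φ.injective).trans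
    (Equiv.setCongr (by simp)), Iff.rfl⟩⟩

theorem subClass_map_range {n : ℕ} (G : SimpleGraph (Fin n)) :
    subClass (G.map Fin.valEmbedding) (Finset.range n) = isoClass G := by
  rw [← Nat.Iio_eq_range, ← Fin.map_valEmbedding_univ, ← isoClass_comap, SimpleGraph.comap_map_eq]

theorem exists_map_univ_eq (S : Finset V) :
    ∃ (n : ℕ) (φ : Fin n ↪ V), Finset.univ.map φ = S :=
  ⟨S.card, S.equivFin.symm.toEmbedding.trans (Function.Embedding.subtype _), by
    rw [← Finset.map_map, Finset.map_univ_equiv]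
    exact Finset.attach_map_val⟩

theorem ind_eq_card [Fintype V] [DecidableEq GraphClass] (H : GraphClass) :
    ind H G = (Finset.univ.filter fun A : Finset V => subClass G A = H).card := by
  rw [ind, ← Set.ncard_coe_finset]
  refine (Set.ncard_congr (fun (A : Finset V) _ => (A : Set V)) (fun A hA => ?_)
    (fun A B _ _ h => by exact_mod_cast h) fun B hB => ?_).symm
  · exact (Finset.mem_filter.1 (Finset.mem_coe.1 hA)).2
  · lift B to Finset V using B.toFinite
    exact ⟨B, Finset.mem_coe.2 (Finset.mem_filter.2 ⟨Finset.mem_univ _, hB⟩), rfl⟩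

theorem sum_orderLE_mul_ind {R : Type*} [CommSemiring R] [Fintype V] (d : ℕ)
    (l : GraphClass → R) :
    ∑ H ∈ GraphClass.orderLE d, l H * (ind H G : R) =
      ∑ A : Finset V, if A.card ≤ d then l (subClass G A) else 0 := by
  classical
  have hmaps : ∀ A ∈ Finset.univ.filter fun A : Finset V => A.card ≤ d,
      subClass G A ∈ GraphClass.orderLE d := fun A hA => by
    simpa [GraphClass.orderLE, order_subClass] using hA
  rw [← Finset.sum_filter, ← Finset.sum_fiberwise_of_maps_to hmaps]
  refine Finset.sum_congr rfl fun H hH => ?_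
  have hfiber : ((Finset.univ.filter fun A : Finset V => A.card ≤ d).filter
      fun A => subClass G A = H) = Finset.univ.filter fun A => subClass G A = H := by
    ext A
    simp only [Finset.mem_filter, Finset.mem_univ, true_and, and_iff_right_iff_imp]
    rintro rfl
    simpa [GraphClass.orderLE, order_subClass] using hH
  rw [hfiber, Finset.sum_congr rfl fun A hA => by rw [(Finset.mem_filter.1 hA).2],
    Finset.sum_const, nsmul_eq_mul, mul_comm, ind_eq_card]

/-- Condition (i) in the definition of a BIGCP: the coefficients of `p` are the combinations, with
coefficients `lam`, of the numbers of induced subgraphs with at most `α * i` vertices. -/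
def HasInducedExpansion (p : GraphClass → ℂ[X]) (α : ℕ) (lam : GraphClass → ℕ → ℂ) : Prop :=
  ∀ (n : ℕ) (G : SimpleGraph (Fin n)) (i : ℕ), (p (isoClass G)).coeff i =
    ∑ H ∈ GraphClass.orderLE (α * i), lam H i * (ind H G : ℂ)

variable {p : GraphClass → ℂ[X]} {α : ℕ} {lam : GraphClass → ℕ → ℂ}

theorem HasInducedExpansion.coeff_subClass (h : HasInducedExpansion p α lam) (S : Finset V)
    (i : ℕ) : (p (subClass G S)).coeff i =
      ∑ T ∈ S.powerset, if T.card ≤ α * i then lam (subClass G T) i else 0 := by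
  obtain ⟨n, φ, rfl⟩ := exists_map_univ_eq S
  rw [← isoClass_comap, h, sum_orderLE_mul_ind _ _ fun H => lam H i]
  refine Finset.sum_bij (fun A _ => A.map φ) (fun A _ => ?_)
    (fun A _ B _ hAB => Finset.map_injective φ hAB) (fun T hT => ?_) fun A _ => ?_
  · exact Finset.mem_powerset.2 (Finset.map_subset_map.2 (Finset.subset_univ A))
  · obtain ⟨A, -, rfl⟩ := Finset.subset_map_iff.1 (Finset.mem_powerset.1 hT)
    exact ⟨A, Finset.mem_univ _, rfl⟩
  · rw [Finset.card_map, subClass_comap]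

theorem IsMultiplicative.subClass_empty (hp : IsMultiplicative p) : p (subClass G ∅) = 1 := by
  rw [← hp.1]
  congr 1
  have : IsEmpty ((∅ : Finset V) : Set V) := by simp
  exact (isoClass_eq_iff _ _).2 ⟨⟨Equiv.equivOfIsEmpty _ _, fun {a} => isEmptyElim a⟩⟩

theorem IsMultiplicative.subClass_union [DecidableEq V] (hp : IsMultiplicative p)
    {A B : Finset V} (hAB : Disjoint A B) (hadj : ∀ a ∈ A, ∀ b ∈ B, ¬G.Adj a b) :
    p (subClass G (A ∪ B)) = p (subClass G A) * p (subClass G B) := by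
  obtain ⟨m, φ, rfl⟩ := exists_map_univ_eq A
  obtain ⟨n, ψ, rfl⟩ := exists_map_univ_eq B
  have hφ : ∀ a, φ a ∈ Finset.univ.map φ := by simp
  have hψ : ∀ b, ψ b ∈ Finset.univ.map ψ := by simp
  let χ : Fin m ⊕ Fin n ↪ V := ⟨Sum.elim φ ψ, φ.injective.sumElim ψ.injective
    fun a b h => Finset.disjoint_left.1 hAB (hφ a) (h ▸ hψ b)⟩
  have hχ : Finset.univ.map χ = Finset.univ.map φ ∪ Finset.univ.map ψ := by
    ext v
    simp [χ]
  have hsum : SimpleGraph.sum (G.comap φ) (G.comap ψ) = G.comap χ := by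
    ext a b
    rcases a with a | a <;> rcases b with b | b
    · simp [χ]
    · simpa [χ] using hadj _ (hφ a) _ (hψ b)
    · simpa [χ] using fun h : G.Adj _ _ => hadj _ (hφ b) _ (hψ a) h.symm
    · simp [χ]
  rw [← hχ, ← isoClass_comap, ← hsum, hp.2, isoClass_comap, isoClass_comap]

/-- The set function `S ↦ p_j(G[S])`, where `p_j` is the `j`-th inverse power sum. -/
def localInvPowerSum (p : GraphClass → ℂ[X]) (j : ℕ) (S : Finset V) : ℂ :=
  invPowerSum (p (subClass G S)) j

theorem HasInducedExpansion.hasDegreeLE (h : HasInducedExpansion p α lam)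
    (hzero : ∀ H, (p H).coeff 0 = 1) (j : ℕ) :
    HasDegreeLE (α * (j + 1)) (localInvPowerSum G p (j + 1)) :=
  HasDegreeLE.invPowerSum (fun _ => hzero _) (fun i =>
    ⟨fun T => if T.card ≤ α * i then lam (subClass G T) i else 0,
      fun _ hT => if_neg (not_le.mpr hT), fun S => h.coeff_subClass G S i⟩) j

theorem localInvPowerSum_union [DecidableEq V] (hp : IsMultiplicative p) (hne : ∀ H, p H ≠ 0)
    {A B : Finset V} (hAB : Disjoint A B) (hadj : ∀ a ∈ A, ∀ b ∈ B, ¬G.Adj a b) (j : ℕ) :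
    localInvPowerSum G p j (A ∪ B) = localInvPowerSum G p j A + localInvPowerSum G p j B := by
  rw [localInvPowerSum, hp.subClass_union G hAB hadj,
    invPowerSum_mul (mul_ne_zero (hne _) (hne _))]
  rfl

theorem mobius_localInvPowerSum_empty (hp : IsMultiplicative p) (j : ℕ) :
    mobius (localInvPowerSum G p j) ∅ = 0 := by
  simp [mobius, localInvPowerSum, hp.subClass_empty, invPowerSum_one]

theorem mobius_localInvPowerSum_union [DecidableEq V] (hp : IsMultiplicative p)
    (hne : ∀ H, p H ≠ 0) {A B : Finset V} (hA : A.Nonempty) (hB : B.Nonempty)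
    (hAB : Disjoint A B) (hadj : ∀ a ∈ A, ∀ b ∈ B, ¬G.Adj a b) (j : ℕ) :
    mobius (localInvPowerSum G p j) (A ∪ B) = 0 := by
  refine mobius_union_eq_zero (fun h => hA.ne_empty ?_) (fun h => hB.ne_empty ?_) fun S hS => ?_
  · exact Finset.disjoint_self_iff_empty A |>.1 (hAB.mono_right h)
  · exact Finset.disjoint_self_iff_empty B |>.1 (hAB.mono_left h)
  · rw [← localInvPowerSum_union G hp hne
      (hAB.mono Finset.inter_subset_right Finset.inter_subset_right)
      (fun a ha b hb => hadj a (Finset.mem_of_mem_inter_right ha) b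
        (Finset.mem_of_mem_inter_right hb)),
      ← Finset.inter_union_distrib_left, Finset.inter_eq_left.2 hS]

end InducedSubgraphs

/-! ### Correctness of the search -/

/-- The conditions that every state of the search satisfies. -/
structure SearchState.Invariant (g : List (List ℕ)) (q : SearchState) : Prop where
  nodup : q.chosen.Nodup
  ne_nil : q.chosen ≠ []
  chosen_lt : ∀ a ∈ q.chosen, a < g.length
  pending_lt : ∀ a ∈ q.pending, a < g.length
  notMem_excluded : ∀ a ∈ q.chosen, a ∉ q.excluded
  neighbor_mem : ∀ a ∈ q.chosen, ∀ v ∈ g.getD a [],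
    v ∈ q.chosen ∨ v ∈ q.excluded ∨ v ∈ q.pending

namespace SearchState.Invariant

variable {g : List (List ℕ)} {A X F : List ℕ} {w : ℕ}

theorem skip (h : Invariant g ⟨A, X, w :: F⟩) (hw : w ∈ A ∨ w ∈ X) : Invariant g ⟨A, X, F⟩ where
  nodup := h.nodup
  ne_nil := h.ne_nil
  chosen_lt := h.chosen_lt
  pending_lt a ha := h.pending_lt a (List.mem_cons_of_mem w ha)
  notMem_excluded := h.notMem_excluded
  neighbor_mem a ha v hv := by
    have := h.neighbor_mem a ha v hv
    grind

theorem exclude (h : Invariant g ⟨A, X, w :: F⟩) (hw : w ∉ A) : Invariant g ⟨A, w :: X, F⟩ where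
  nodup := h.nodup
  ne_nil := h.ne_nil
  chosen_lt := h.chosen_lt
  pending_lt a ha := h.pending_lt a (List.mem_cons_of_mem w ha)
  notMem_excluded a ha := by
    have := h.notMem_excluded a ha
    grind
  neighbor_mem a ha v hv := by
    have := h.neighbor_mem a ha v hv
    grind

theorem choose (hg : ∀ a, ∀ v ∈ g.getD a [], v < g.length) (h : Invariant g ⟨A, X, w :: F⟩)
    (hA : w ∉ A) (hX : w ∉ X) : Invariant g ⟨w :: A, X, g.getD w [] ++ F⟩ where
  nodup := List.nodup_cons.2 ⟨hA, h.nodup⟩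
  ne_nil := List.cons_ne_nil w A
  chosen_lt := List.forall_mem_cons.2 ⟨h.pending_lt w List.mem_cons_self, h.chosen_lt⟩
  pending_lt := List.forall_mem_append.2
    ⟨hg w, fun a ha => h.pending_lt a (List.mem_cons_of_mem w ha)⟩
  notMem_excluded := List.forall_mem_cons.2 ⟨hX, h.notMem_excluded⟩
  neighbor_mem := by
    refine List.forall_mem_cons.2 ⟨fun v hv => .inr (.inr (List.mem_append_left F hv)),
      fun a ha v hv => ?_⟩
    have := h.neighbor_mem a ha v hv
    grind

theorem of_mem_searchStep (hg : ∀ a, ∀ v ∈ g.getD a [], v < g.length) {s : ℕ}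
    {q q' : SearchState} (h : q.Invariant g) (hq' : q' ∈ searchStep g s q) : q'.Invariant g := by
  unfold searchStep at hq'
  split at hq'
  · rwa [List.mem_singleton.mp hq']
  · split_ifs at hq' with hw hs
    · rw [List.mem_singleton.mp hq']
      exact h.skip hw
    · rw [not_or] at hw
      rcases List.mem_pair.mp hq' with rfl | rfl
      · exact h.choose hg hw.1 hw.2
      · exact h.exclude hw.1
    · rw [List.mem_singleton.mp hq']
      exact h.exclude (not_or.mp hw).1

theorem of_mem_search (hg : ∀ a, ∀ v ∈ g.getD a [], v < g.length) {s r : ℕ} :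
    ∀ q ∈ search g s r, q.Invariant g := by
  induction r with
  | zero =>
    simp only [search, searchInit, List.mem_map, List.mem_range, forall_exists_index, and_imp,
      forall_apply_eq_imp_iff₂]
    exact fun v hv =>
      { nodup := List.nodup_singleton v
        ne_nil := List.cons_ne_nil v []
        chosen_lt := by simpa using hv
        pending_lt := hg v
        notMem_excluded := by simp
        neighbor_mem := by simpa using fun w hw => .inr (.inr hw) }
  | succ r ih =>
    intro q' hq'
    obtain ⟨q, hq, h⟩ := List.mem_flatMap.mp hq'
    exact (ih q hq).of_mem_searchStep hg h

end SearchState.Invariant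

section Weight

variable {R : Type*} [AddCommGroup R] (n : ℕ) (c : Finset ℕ → R)

/-- The sum of `c S` over the sets `S` of vertices less than `n` that a state of the search stands
for, whether connected or not: those that contain `A` and avoid `X`. -/
def weight (A X : List ℕ) : R :=
  ∑ S ∈ (Finset.range n).powerset with (∀ a ∈ A, a ∈ S) ∧ ∀ x ∈ X, x ∉ S, c S

theorem weight_cons_add_weight_cons (A X : List ℕ) (w : ℕ) :
    weight n c (w :: A) X + weight n c A (w :: X) = weight n c A X := by
  unfold weight
  rw [← Finset.sum_filter_add_sum_filter_not (Finset.filter (fun S => (∀ a ∈ A, a ∈ S) ∧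
    ∀ x ∈ X, x ∉ S) (Finset.range n).powerset) (fun S => w ∈ S)]
  congr 1 <;> refine Finset.sum_congr ?_ fun _ _ => rfl <;> ext S <;>
    simp only [Finset.mem_filter, List.forall_mem_cons] <;> tauto

theorem weight_singleton {v : ℕ} (hv : v < n) :
    weight n c [v] ((List.range n).filter fun w => decide (v < w)) =
      ∑ S ∈ (Finset.range (v + 1)).powerset, c S - ∑ S ∈ (Finset.range v).powerset, c S := by
  have hsets : ((Finset.range n).powerset.filter fun S => (∀ a ∈ [v], a ∈ S) ∧
      ∀ x ∈ (List.range n).filter fun w => decide (v < w), x ∉ S) =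
      (Finset.range (v + 1)).powerset \ (Finset.range v).powerset := by
    ext S
    simp only [Finset.mem_filter, Finset.mem_sdiff, Finset.mem_powerset, List.mem_singleton,
      forall_eq, List.mem_filter, List.mem_range, decide_eq_true_eq, Finset.subset_iff,
      Finset.mem_range, not_forall]
    constructor
    · rintro ⟨hn, hvS, hlt⟩
      exact ⟨fun a ha => by have := hn ha; have := mt (hlt a) (not_not.2 ha); omega,
        v, hvS, lt_irrefl v⟩
    · rintro ⟨hle, a, ha, hav⟩
      obtain rfl : a = v := by have := hle ha; omega
      exact ⟨fun b hb => by have := hle hb; omega, ha,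
        fun x hx hxS => by have := hle hxS; omega⟩
  rw [weight, hsets, Finset.sum_sdiff_eq_sub
    (Finset.powerset_mono.2 (Finset.range_mono (Nat.le_succ v)))]

variable {n c}

theorem weight_eq_zero {s : ℕ} (hc : ∀ S : Finset ℕ, s < S.card → c S = 0) {A X : List ℕ}
    (hA : A.Nodup) (hs : s < A.length) : weight n c A X = 0 := by
  refine Finset.sum_eq_zero fun S hS => hc S ?_
  have hsub : A.toFinset ⊆ S := fun a ha =>
    (Finset.mem_filter.mp hS).2.1 a (List.mem_toFinset.mp ha)
  rw [← List.toFinset_card_of_nodup hA] at hs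
  exact hs.trans_le (Finset.card_le_card hsub)

theorem SearchState.Invariant.weight_eq {g : List (List ℕ)} {q : SearchState}
    (h : q.Invariant g) (hq : q.pending = [])
    (hc : ∀ A B : Finset ℕ, A.Nonempty → B.Nonempty → Disjoint A B →
      (∀ a ∈ A, ∀ b ∈ B, b ∉ g.getD a []) → c (A ∪ B) = 0) :
    weight g.length c q.chosen q.excluded = c q.chosen.toFinset := by
  rw [weight, Finset.sum_eq_single q.chosen.toFinset]
  · intro S hS hne
    obtain ⟨-, hchosen, hexcluded⟩ := Finset.mem_filter.mp hS
    have hsub : q.chosen.toFinset ⊆ S := fun a ha => hchosen a (List.mem_toFinset.mp ha)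
    rw [← Finset.union_sdiff_of_subset hsub]
    refine hc _ _ ((List.toFinset_nonempty_iff _).2 h.ne_nil)
      (Finset.sdiff_nonempty.2 fun hle => hne (hle.antisymm hsub)) Finset.disjoint_sdiff ?_
    intro a ha b hb hab
    rw [Finset.mem_sdiff, List.mem_toFinset] at hb
    rcases h.neighbor_mem a (List.mem_toFinset.mp ha) b hab with hb' | hb' | hb'
    · exact hb.2 hb'
    · exact hexcluded b hb' hb.1
    · simp [hq] at hb'
  · refine fun hmem => absurd (Finset.mem_filter.mpr ⟨?_, ?_, ?_⟩) hmem
    · exact Finset.mem_powerset.mpr fun a ha =>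
        Finset.mem_range.mpr (h.chosen_lt a (List.mem_toFinset.mp ha))
    · exact fun a ha => List.mem_toFinset.mpr ha
    · exact fun x hx hxA => h.notMem_excluded x (List.mem_toFinset.mp hxA) hx

theorem sum_weight_searchStep {g : List (List ℕ)} {s : ℕ}
    (hc : ∀ S : Finset ℕ, s < S.card → c S = 0) {q : SearchState} (hq : q.chosen.Nodup) :
    ((searchStep g s q).map fun q' => weight n c q'.chosen q'.excluded).sum =
      weight n c q.chosen q.excluded := by
  unfold searchStep
  split
  · simp
  next A X w F =>
    split_ifs with hw hs
    · simp
    · simpa using weight_cons_add_weight_cons n c A X w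
    · have hfull : weight n c (w :: A) X = 0 :=
        weight_eq_zero hc (List.nodup_cons.2 ⟨(not_or.mp hw).1, hq⟩)
          (Nat.lt_succ_of_le (not_lt.mp hs))
      simpa [hfull] using weight_cons_add_weight_cons n c A X w

theorem sum_weight_search {g : List (List ℕ)} (hg : ∀ a, ∀ v ∈ g.getD a [], v < g.length)
    {s r : ℕ} (hc : ∀ S : Finset ℕ, s < S.card → c S = 0) :
    ((search g s r).map fun q => weight g.length c q.chosen q.excluded).sum =
      ∑ S ∈ (Finset.range g.length).powerset, c S - c ∅ := by
  induction r with
  | zero =>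
    simp only [search, searchInit, List.map_map, Function.comp_def]
    rw [← List.sum_toFinset _ List.nodup_range, List.toFinset_range,
      Finset.sum_congr rfl fun v hv => weight_singleton g.length c (Finset.mem_range.1 hv),
      Finset.sum_range_sub (fun v => ∑ S ∈ (Finset.range v).powerset, c S)]
    simp
  | succ r ih =>
    rw [← ih, search, List.map_flatMap, List.flatMap_def, List.sum_flatten, List.map_map]
    exact congrArg _ (List.map_congr_left fun q hq =>
      sum_weight_searchStep hc (SearchState.Invariant.of_mem_search hg q hq).nodup)

theorem sum_search {g : List (List ℕ)} {d s r : ℕ} (hg : ∀ a, ∀ v ∈ g.getD a [], v < g.length)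
    (hd : ∀ l ∈ g, l.length ≤ d) (hs : 1 ≤ s) (hr : d * s ≤ r)
    (hcard : ∀ S : Finset ℕ, s < S.card → c S = 0)
    (hunion : ∀ A B : Finset ℕ, A.Nonempty → B.Nonempty → Disjoint A B →
      (∀ a ∈ A, ∀ b ∈ B, b ∉ g.getD a []) → c (A ∪ B) = 0) :
    ((search g s r).map fun q => c q.chosen.toFinset).sum =
      ∑ S ∈ (Finset.range g.length).powerset, c S - c ∅ := by
  rw [← sum_weight_search (r := r) hg hcard]
  exact congrArg _ (List.map_congr_left fun q hq =>
    ((SearchState.Invariant.of_mem_search hg q hq).weight_eq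
      (pending_eq_nil_of_mem_search hd hs hr q hq) hunion).symm)

end Weight

/-! ### Correctness of the algorithm -/

/-- `g` is a list of adjacency lists of the graph `G`, whose edges join natural numbers less than
the length of `g`. -/
structure IsAdjList (g : List (List ℕ)) (G : SimpleGraph ℕ) : Prop where
  mem_iff : ∀ a v, v ∈ g.getD a [] ↔ G.Adj a v
  lt_length : ∀ a v, G.Adj a v → v < g.length

theorem IsAdjList.lt_length_of_mem {g : List (List ℕ)} {G : SimpleGraph ℕ} (hg : IsAdjList g G)
    (a v : ℕ) (hv : v ∈ g.getD a []) : v < g.length :=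
  hg.lt_length a v ((hg.mem_iff a v).mp hv)

/-- The number `λ_{H, i}` of the subgraph `H` induced on the list `U`. -/
def listCoeff (lam : GraphClass → ℕ → ℂ) (G : SimpleGraph ℕ) (U : List ℕ) (i : ℕ) : ℂ :=
  lam (subClass G U.toFinset) i

section Correctness

variable {p : GraphClass → ℂ[X]} {α : ℕ} {lam : GraphClass → ℕ → ℂ} (G : SimpleGraph ℕ)

theorem coeffSum_eq_coeff (h : HasInducedExpansion p α lam) {T : List ℕ} (hT : T.Nodup) :
    coeffSum α (listCoeff lam G) T = (p (subClass G T.toFinset)).coeff := by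
  funext i
  rw [h.coeff_subClass]
  refine sum_map_sublists' hT fun U hU => ?_
  rw [List.toFinset_card_of_nodup (nodup_of_mem_sublists' hT hU)]
  rfl

theorem localPowerSum_eq (h : HasInducedExpansion p α lam) (hzero : ∀ H, (p H).coeff 0 = 1)
    {T : List ℕ} (hT : T.Nodup) (j : ℕ) :
    localPowerSum α (listCoeff lam G) (j + 1) T = localInvPowerSum G p (j + 1) T.toFinset := by
  rw [localPowerSum, coeffSum_eq_coeff G h hT, newton_coeff (hzero _),
    List.getD_eq_getElem _ _ (by simp), List.getElem_map, List.getElem_range]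
  rfl

variable {G}

theorem sum_search_listMobius (hp : IsMultiplicative p) (h : HasInducedExpansion p α lam)
    (hzero : ∀ H, (p H).coeff 0 = 1) {g : List (List ℕ)} (hg : IsAdjList g G) {d s r j : ℕ}
    (hd : ∀ l ∈ g, l.length ≤ d) (hs : α * (j + 1) ≤ s) (hs_pos : 1 ≤ s) (hr : d * s ≤ r) :
    ((search g s r).map fun q =>
      listMobius (localPowerSum α (listCoeff lam G) (j + 1)) q.chosen).sum =
        invPowerSum (p (subClass G (Finset.range g.length))) (j + 1) := by
  have hne : ∀ H, p H ≠ 0 := fun H hH => by simpa [hH] using hzero H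
  have hterm : ∀ q ∈ search g s r,
      listMobius (localPowerSum α (listCoeff lam G) (j + 1)) q.chosen =
        mobius (localInvPowerSum G p (j + 1)) q.chosen.toFinset := fun q hq =>
    have hnodup := (SearchState.Invariant.of_mem_search hg.lt_length_of_mem q hq).nodup
    listMobius_eq hnodup fun T hT =>
      localPowerSum_eq G h hzero (nodup_of_mem_sublists' hnodup hT) j
  rw [List.map_congr_left hterm, sum_search hg.lt_length_of_mem hd hs_pos hr, sum_powerset_mobius,
    mobius_localInvPowerSum_empty G hp, sub_zero, localInvPowerSum]
  · exact fun S hS => (h.hasDegreeLE G hzero j).mobius_eq_zero (hs.trans_lt hS)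
  · exact fun A B hA hB hAB hadj => mobius_localInvPowerSum_union G hp hne hA hB hAB
      (fun a ha b hb => mt (hg.mem_iff a b).mpr (hadj a ha b hb)) _

end Correctness

/-! ### Adjacency lists -/

section AdjList

variable {n : ℕ} (G : SimpleGraph (Fin n)) [DecidableRel G.Adj]

/-- The adjacency lists of a graph on `{0, …, n - 1}`. -/
def adjList : List (List ℕ) :=
  (List.finRange n).map fun v => ((List.finRange n).filter fun w => G.Adj v w).map Fin.val

theorem enc_adjList : enc (adjList G) = encGraph G := by
  simp only [enc, adjList, encGraph, List.map_map]
  refine congrArg _ (List.map_congr_left fun v _ => ?_)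
  simp [← List.map_eq_flatMap, Function.comp_def]

theorem length_adjList : (adjList G).length = n := by simp [adjList]

theorem length_le_of_mem_adjList {Δ : ℕ} (hG : G.maxDegree ≤ Δ) :
    ∀ l ∈ adjList G, l.length ≤ Δ := by
  intro l hl
  obtain ⟨v, -, rfl⟩ := List.mem_map.1 hl
  have hdegree : ((List.finRange n).filter fun w => G.Adj v w).length = G.degree v := by
    rw [← List.toFinset_card_of_nodup ((List.nodup_finRange n).filter _),
      ← SimpleGraph.card_neighborFinset_eq_degree]
    congr 1
    ext w
    simp
  rw [List.length_map, hdegree]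
  exact (G.degree_le_maxDegree v).trans hG

theorem mem_getD_adjList (a v : ℕ) :
    v ∈ (adjList G).getD a [] ↔ (G.map Fin.valEmbedding).Adj a v := by
  rw [SimpleGraph.map_adj]
  by_cases ha : a < n
  · rw [List.getD_eq_getElem _ _ (by simpa [adjList] using ha)]
    simp only [adjList, List.getElem_map, List.mem_map, List.mem_filter, List.mem_finRange,
      true_and, List.getElem_finRange, decide_eq_true_eq]
    refine ⟨fun ⟨w, hw, hwv⟩ => ⟨_, w, hw, rfl, hwv⟩, ?_⟩
    rintro ⟨b, w, hw, rfl, rfl⟩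
    exact ⟨w, hw, rfl⟩
  · rw [List.getD_eq_default _ _ (by simpa [adjList] using ha)]
    simp only [List.not_mem_nil, false_iff]
    rintro ⟨b, w, -, rfl, -⟩
    exact ha b.2

theorem isAdjList_adjList : IsAdjList (adjList G) (G.map Fin.valEmbedding) where
  mem_iff := mem_getD_adjList G
  lt_length a v h := by
    obtain ⟨-, w, -, -, rfl⟩ := (SimpleGraph.map_adj ..).1 h
    rw [length_adjList]
    exact w.2

end AdjList

theorem inducedAdj_eq_adjList {G : SimpleGraph ℕ} {g : List (List ℕ)} (hg : IsAdjList g G)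
    (U : List ℕ) [DecidableRel (G.comap U.get).Adj] :
    inducedAdj g U = adjList (G.comap U.get) := by
  rw [inducedAdj, adjList, ← List.map_coe_finRange_eq_range, List.map_map]
  refine List.map_congr_left fun a _ => ?_
  rw [Function.comp_apply, List.filter_map]
  refine congrArg _ (List.filter_congr fun b _ => ?_)
  rw [Function.comp_apply, decide_eq_decide, hg.mem_iff, List.getD_eq_getElem _ _ a.2,
    List.getD_eq_getElem _ _ b.2]
  rfl

theorem isoClass_comap_get {V : Type*} [DecidableEq V] (G : SimpleGraph V) {U : List V}
    (hU : U.Nodup) : isoClass (G.comap U.get) = subClass G U.toFinset := by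
  have h := isoClass_comap G ⟨U.get, List.nodup_iff_injective_get.mp hU⟩
  refine h.trans (congrArg _ ?_)
  ext v
  simp only [Finset.mem_map, Finset.mem_univ, true_and, List.mem_toFinset, List.mem_iff_get]
  exact Iff.rfl

/-! ### Problem instances -/

namespace PolyTime

variable {ι Γ : Type} [Enc Γ] {M : ι → ℕ} {u : ι → Γ} {g : ι → List (List ℕ)}
  {G : ι → SimpleGraph ℕ} {d α β : ℕ} {lam : GraphClass → ℕ → ℂ} {P : Prog}

theorem listCoeff (hP : ComputesCoefficients P lam α β) (hG : ∀ i, IsAdjList (g i) (G i))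
    (hg : PolyTime M u g) (hglen : PolyBounded M fun i => (g i).length)
    (hrow : ∀ i, ∀ l ∈ g i, l.length ≤ d) {U : ι → List ℕ} {k : ι → ℕ} (hU : PolyTime M u U)
    (hk : PolyTime M u k) (hUlen : PolyBounded M fun i => 2 ^ (U i).length)
    (hnodup : ∀ i, (U i).Nodup) (hle : ∀ i, (U i).length ≤ α * k i) :
    PolyTime M u fun i => listCoeff lam (G i) (U i) (k i) := by
  classical
  obtain ⟨K, hK⟩ := hP
  refine ((inducedAdj hg hU hglen hrow (hUlen.mono fun i => Nat.lt_two_pow_self.le)).pair hk).trans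
    (of_le P ((PolyBounded.const K).mul (hUlen.pow β)) fun i => ?_)
  obtain ⟨t, hrun, ht⟩ := hK (U i).length ((G i).comap (U i).get) (k i) (hle i)
  refine ⟨t, ht.trans (Nat.mul_le_mul_left K ?_), ?_⟩
  · rw [← pow_mul, mul_comm, pow_mul]
    exact Nat.pow_le_pow_left Nat.lt_two_pow_self.le _
  · rw [isoClass_comap_get _ (hnodup i), ← enc_adjList, ← inducedAdj_eq_adjList (hG i)] at hrun
    exact hrun

theorem listMobius_localPowerSum (hP : ComputesCoefficients P lam α β)
    (hG : ∀ i, IsAdjList (g i) (G i)) (hg : PolyTime M u g)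
    (hglen : PolyBounded M fun i => (g i).length) (hrow : ∀ i, ∀ l ∈ g i, l.length ≤ d)
    {A : ι → List ℕ} {k : ι → ℕ} (hA : PolyTime M u A) (hk : PolyTime M u k)
    (hAlen : PolyBounded M fun i => 2 ^ (A i).length) (hnodup : ∀ i, (A i).Nodup)
    (hkbound : PolyBounded M k) :
    PolyTime M u fun i =>
      _root_.listMobius (_root_.localPowerSum α (_root_.listCoeff lam (G i)) (k i)) (A i) := by
  let J := Idx fun i T => T ∈ (A i).sublists'
  have hTlen : PolyBounded (fun j : J => M j.i) fun j => 2 ^ j.x.length :=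
    (hAlen.comap Idx.i).mono fun j =>
      Nat.pow_le_pow_right two_pos (List.mem_sublists'.mp j.prop).length_le
  refine hA.listMobius hAlen (localPowerSum var hk.lift hTlen (hkbound.comap Idx.i) ?_)
  refine listCoeff (g := fun j => g j.i.i) hP (fun j => hG j.i.i) hg.lift.lift
    ((hglen.comap Idx.i).comap Idx.i) (fun j => hrow j.i.i) var.fst var.snd
    ((hTlen.comap Idx.i).mono fun j => Nat.pow_le_pow_right two_pos ?_) (fun j => ?_)
    (fun j => j.prop.2)
  · exact (List.mem_sublists'.mp j.prop.1).length_le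
  · exact nodup_of_mem_sublists' (nodup_of_mem_sublists' (hnodup j.i.i) j.i.prop) j.prop.1

theorem sum_search_listMobius (hP : ComputesCoefficients P lam α β)
    (hG : ∀ i, IsAdjList (g i) (G i)) (hg : PolyTime M u g)
    (hglen : PolyBounded M fun i => (g i).length) (hrow : ∀ i, ∀ l ∈ g i, l.length ≤ d)
    {s r k : ι → ℕ} (hs : PolyTime M u s) (hr : PolyTime M u r) (hk : PolyTime M u k)
    (hs_pos : ∀ i, 1 ≤ s i) (hspow : PolyBounded M fun i => 2 ^ s i)
    (hrpow : PolyBounded M fun i => 2 ^ r i) (hkbound : PolyBounded M k) :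
    PolyTime M u fun i => ((_root_.search (g i) (s i) (r i)).map fun q => _root_.listMobius
      (_root_.localPowerSum α (_root_.listCoeff lam (G i)) (k i)) q.chosen).sum := by
  have hsearch := hg.search hs hr hglen hrow hs_pos
    (hspow.mono fun i => Nat.lt_two_pow_self.le) hrpow
  have hsearchlen : PolyBounded M fun i => (_root_.search (g i) (s i) (r i)).length :=
    (hrpow.mul hglen).mono fun i => length_search_le _ _ _
  let J := Idx fun i q => q ∈ _root_.search (g i) (s i) (r i)
  have hchosenlen : PolyBounded (fun j : J => M j.i) fun j => 2 ^ j.x.chosen.length :=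
    (hspow.comap Idx.i).mono fun j => Nat.pow_le_pow_right two_pos
      (length_chosen_le_of_mem_search (hs_pos j.i) _ j.prop)
  have hnodup : ∀ j : J, j.x.chosen.Nodup := fun j =>
    (SearchState.Invariant.of_mem_search (hG j.i).lt_length_of_mem _ j.prop).nodup
  exact (hsearch.map hsearchlen (listMobius_localPowerSum hP (fun j : J => hG j.i) hg.lift
    (hglen.comap Idx.i) (fun j => hrow j.i) var.chosen hk.lift hchosenlen hnodup
    (hkbound.comap Idx.i))).complex_sum (by simpa using hsearchlen)

theorem invPowerSum_succ {p : GraphClass → ℂ[X]} (hp : IsMultiplicative p)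
    (hzero : ∀ H, (p H).coeff 0 = 1) (hlam : HasInducedExpansion p α lam)
    (hP : ComputesCoefficients P lam α β) (hG : ∀ i, IsAdjList (g i) (G i))
    (hg : PolyTime M u g) (hglen : PolyBounded M fun i => (g i).length)
    (hrow : ∀ i, ∀ l ∈ g i, l.length ≤ d) {k : ι → ℕ} (hk : PolyTime M u k)
    (hkpow : PolyBounded M fun i => 2 ^ k i) :
    PolyTime M u fun i =>
      invPowerSum (p (subClass (G i) (Finset.range (g i).length))) (k i + 1) := by
  let s (i : ι) : ℕ := α * (k i + 1) + 1
  have hs_pos : ∀ i, 1 ≤ s i := fun i => Nat.le_add_left _ _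
  have hs : PolyTime M u s := ((const α).nat_mul (hk.nat_add (const 1))).nat_add (const 1)
  have hspow : PolyBounded M fun i => 2 ^ s i :=
    (((hkpow.mul (.const 2)).pow α).mul (.const 2)).mono fun i => by
      rw [← pow_succ, ← pow_mul, ← pow_succ, mul_comm]
  have hrpow : PolyBounded M fun i => 2 ^ (d * s i) :=
    (hspow.pow d).mono fun i => by rw [← pow_mul, mul_comm]
  have hkbound : PolyBounded M fun i => k i + 1 :=
    (hkpow.mono fun i => Nat.lt_two_pow_self.le).add (.const 1)
  exact (sum_search_listMobius hP hG hg hglen hrow hs ((const d).nat_mul hs) (hk.nat_add (const 1))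
    hs_pos hspow hrpow hkbound).congr fun i =>
      _root_.sum_search_listMobius hp hlam hzero (hG i) (hrow i) (Nat.le_succ _) (hs_pos i) le_rfl

end PolyTime

theorem lt_ceil_mul_log_iff {C x ε : ℝ} (hC : 0 < C) (hx : 0 < x) (hε : 0 < ε) (j : ℕ) :
    j < ⌈C * Real.log (x / ε)⌉₊ ↔ ¬x ≤ ε * Real.exp (1 / C) ^ j := by
  rw [← not_le, Nat.ceil_le, not_iff_not, ← Real.exp_nat_mul, mul_comm ε, ← div_le_iff₀ hε,
    ← Real.log_le_iff_le_exp (div_pos hx hε), mul_one_div, le_div_iff₀ hC, mul_comm C]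

/-- An input of the algorithm. -/
structure ProblemInstance (Δ : ℕ) : Type where
  n : ℕ
  G : SimpleGraph (Fin n)
  /-- the decidability of adjacency, on which the encoding of the graph depends -/
  dec : DecidableRel G.Adj
  ε : ℝ
  n_pos : 0 < n
  maxDegree_le : G.maxDegree ≤ Δ
  ε_pos : 0 < ε

namespace ProblemInstance

variable {Δ : ℕ}

instance (i : ProblemInstance Δ) : DecidableRel i.G.Adj := i.dec

/-- The size `n + n / ε` of an input, rounded up. -/
def size (i : ProblemInstance Δ) : ℕ := i.n + ⌈(i.n : ℝ) / i.ε⌉₊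

/-- The input in the form in which it is given to the program. -/
def input (i : ProblemInstance Δ) : List (List ℕ) × ℝ := (adjList i.G, i.ε)

/-- The number of inverse power sums that are asked for. -/
def num (C : ℝ) (i : ProblemInstance Δ) : ℕ := ⌈C * Real.log ((i.n : ℝ) / i.ε)⌉₊

theorem enc_input (i : ProblemInstance Δ) : enc i.input = .cons (encGraph i.G) (.num i.ε) := by
  rw [← enc_adjList]
  rfl

theorem polyBounded_n : PolyBounded (size (Δ := Δ)) n :=
  PolyBounded.size.mono fun _ => Nat.le_add_right _ _

theorem size_add_two_le (i : ProblemInstance Δ) :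
    ((i.size + 2 : ℕ) : ℝ) ≤ 5 * max (i.n : ℝ) ((i.n : ℝ) / i.ε) := by
  have hn : (1 : ℝ) ≤ i.n := by exact_mod_cast i.n_pos
  have hceil : (⌈(i.n : ℝ) / i.ε⌉₊ : ℝ) < (i.n : ℝ) / i.ε + 1 :=
    Nat.ceil_lt_add_one (div_nonneg (Nat.cast_nonneg _) i.ε_pos.le)
  have hleft := le_max_left (i.n : ℝ) ((i.n : ℝ) / i.ε)
  have hright := le_max_right (i.n : ℝ) ((i.n : ℝ) / i.ε)
  simp only [size, Nat.cast_add, Nat.cast_ofNat]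
  linarith

theorem le_mul_max_pow (i : ProblemInstance Δ) {t c : ℕ} (ht : t ≤ (i.size + 2) ^ c) :
    (t : ℝ) ≤ (5 ^ c : ℕ) * max (i.n : ℝ) ((i.n : ℝ) / i.ε) ^ 5 ^ c := by
  have hmax : (1 : ℝ) ≤ max (i.n : ℝ) ((i.n : ℝ) / i.ε) :=
    le_max_of_le_left (by exact_mod_cast i.n_pos)
  calc
    (t : ℝ) ≤ ((i.size + 2 : ℕ) : ℝ) ^ c := by exact_mod_cast ht
    _ ≤ (5 * max (i.n : ℝ) ((i.n : ℝ) / i.ε)) ^ c :=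
      pow_le_pow_left₀ (Nat.cast_nonneg _) i.size_add_two_le c
    _ = (5 ^ c : ℕ) * max (i.n : ℝ) ((i.n : ℝ) / i.ε) ^ c := by rw [mul_pow]; push_cast; rfl
    _ ≤ (5 ^ c : ℕ) * max (i.n : ℝ) ((i.n : ℝ) / i.ε) ^ 5 ^ c :=
      mul_le_mul_of_nonneg_left (pow_le_pow_right₀ hmax (Nat.lt_pow_self (by norm_num)).le)
        (Nat.cast_nonneg _)

theorem num_le {C : ℝ} (hC : 0 < C) (i : ProblemInstance Δ) :
    (i.num C : ℝ) ≤ C * Real.log ((i.size + 2 : ℕ) : ℝ) + 1 := by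
  have hpos : 0 < (i.n : ℝ) / i.ε := div_pos (Nat.cast_pos.2 i.n_pos) i.ε_pos
  have hle : (i.n : ℝ) / i.ε ≤ ((i.size + 2 : ℕ) : ℝ) :=
    (Nat.le_ceil _).trans (Nat.cast_le.2 (by unfold size; omega))
  have hnum : i.num C ≤ ⌈C * Real.log ((i.size + 2 : ℕ) : ℝ)⌉₊ :=
    Nat.ceil_mono (mul_le_mul_of_nonneg_left (Real.log_le_log hpos hle) hC.le)
  exact (Nat.cast_le.2 hnum).trans
    (Nat.ceil_lt_add_one (mul_nonneg hC.le (Real.log_natCast_nonneg _))).le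

theorem polyBounded_two_pow_num {C : ℝ} (hC : 0 < C) :
    PolyBounded (size (Δ := Δ)) fun i => 2 ^ i.num C := by
  obtain ⟨c, hc⟩ := exists_nat_ge (C * Real.log 2 + 1)
  refine ⟨c, fun i => ?_⟩
  have hlog_two : 0 ≤ Real.log 2 := Real.log_nonneg one_le_two
  have hlog : Real.log 2 ≤ Real.log ((i.size + 2 : ℕ) : ℝ) :=
    Real.log_le_log two_pos (by exact_mod_cast Nat.le_add_left 2 i.size)
  have hexponent :
      (i.num C : ℝ) * Real.log 2 ≤ (c : ℝ) * Real.log ((i.size + 2 : ℕ) : ℝ) := by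
    calc
      (i.num C : ℝ) * Real.log 2
          ≤ (C * Real.log ((i.size + 2 : ℕ) : ℝ) + 1) * Real.log 2 :=
        mul_le_mul_of_nonneg_right (num_le hC i) hlog_two
      _ ≤ (C * Real.log 2 + 1) * Real.log ((i.size + 2 : ℕ) : ℝ) := by linarith
      _ ≤ c * Real.log ((i.size + 2 : ℕ) : ℝ) :=
        mul_le_mul_of_nonneg_right hc (hlog_two.trans hlog)
  rw [← Real.log_pow, ← Real.log_pow, Real.log_le_log_iff (by positivity) (by positivity)]
    at hexponent
  exact_mod_cast hexponent

theorem polyTime_num {C : ℝ} (hC : 0 < C) : PolyTime (size (Δ := Δ)) input (num C) := by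
  have hn : PolyTime (size (Δ := Δ)) input n :=
    ((PolyTime.refl.fst.length (by simpa [input, length_adjList] using polyBounded_n)).congr
      fun i => length_adjList i.G)
  have hbound : PolyBounded (size (Δ := Δ)) (num C) :=
    (polyBounded_two_pow_num hC).mono fun _ => Nat.lt_two_pow_self.le
  have hloop := PolyTime.loop hbound (fun i k => (i.ε * Real.exp (1 / C) ^ k, k, i.n))
    (((PolyTime.refl.snd.snd.nat_cast_real.real_le PolyTime.refl.fst).not).congr fun j => by
      rw [← decide_not, decide_eq_decide]
      exact (lt_ceil_mul_log_iff hC (Nat.cast_pos.2 j.i.n_pos) j.i.ε_pos j.x).symm)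
    (((PolyTime.refl.fst.real_mul (.const (Real.exp (1 / C)))).congr fun j => by
      rw [pow_succ, mul_assoc]).pair
        ((PolyTime.refl.snd.fst.nat_add (.const 1)).pair PolyTime.refl.snd.snd))
  have hstart : PolyTime (size (Δ := Δ)) input fun i => (i.ε * Real.exp (1 / C) ^ 0, 0, i.n) :=
    (PolyTime.refl.snd.congr fun i => by rw [pow_zero, mul_one]; rfl).pair
      ((PolyTime.const 0).pair hn)
  exact (hstart.trans hloop).snd.fst

theorem polyTime_invPowerSums {C : ℝ} (hC : 0 < C) {p : GraphClass → ℂ[X]} (hp : IsBIGCP p) :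
    PolyTime (size (Δ := Δ)) input fun i =>
      (List.range (i.num C)).map fun j => invPowerSum (p (isoClass i.G)) (j + 1) := by
  obtain ⟨α, β, lam, hlam, A, hA⟩ := hp.bounded
  have hnum : PolyBounded (size (Δ := Δ)) (num C) :=
    (polyBounded_two_pow_num hC).mono fun _ => Nat.lt_two_pow_self.le
  refine ((polyTime_num hC).range hnum).map (by simpa using hnum)
    ((PolyTime.invPowerSum_succ (g := fun j => adjList j.i.G) hp.multiplicative hp.coeff_zero hlam
      hA (fun j => isAdjList_adjList j.i.G) PolyTime.refl.snd.fst ?_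
      (fun j => length_le_of_mem_adjList j.i.G j.i.maxDegree_le) PolyTime.var ?_).congr
      fun j => by rw [length_adjList, subClass_map_range])
  · simpa only [length_adjList] using polyBounded_n.comap Idx.i
  · exact ((polyBounded_two_pow_num hC).comap Idx.i).mono fun j =>
      Nat.pow_le_pow_right two_pos (List.mem_range.mp j.prop).le

end ProblemInstance

end

theorem theorem3p2 (C : ℝ) (hC : 0 < C) (Δ : ℕ) (p : GraphClass → ℂ[X]) (hp : IsBIGCP p) :
    ∃ (P : Prog) (K : ℕ), ∀ (n : ℕ) (G : SimpleGraph (Fin n)) [DecidableRel G.Adj] (ε : ℝ),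
      0 < n → G.maxDegree ≤ Δ → 0 < ε →
        ∃ t : ℕ,
          P.Run (Val.cons (encGraph G) (Val.num ε))
            (encList ((List.range ⌈C * Real.log ((n : ℝ) / ε)⌉₊).map fun j =>
              encComplex (invPowerSum (p (isoClass G)) (j + 1)))) t ∧
          (t : ℝ) ≤ K * max (n : ℝ) ((n : ℝ) / ε) ^ K := by
  obtain ⟨P, t, ⟨c, hc⟩, hrun⟩ := ProblemInstance.polyTime_invPowerSums (Δ := Δ) hC hp
  refine ⟨P, 5 ^ c, fun n G inst ε hn hG hε => ?_⟩
  let i : ProblemInstance Δ := ⟨n, G, inst, ε, hn, hG, hε⟩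
  refine ⟨t i, ?_, i.le_mul_max_pow (hc i)⟩
  have hrun_i := hrun i
  rw [i.enc_input] at hrun_i
  convert hrun_i using 1
  simp only [Enc.enc, List.map_map]
  rfl
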